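/- Let $\Lambda$ be an Artin algebra, i.e. a ring which is a finitely generated module over some commutative artinian ring $R$ of which it is an algebra, and let $\mathrm{mod}(\Lambda)$ be the category of finitely generated left $\Lambda$-modules. All dimensions below take values in $\mathbb{N}\cup\{\infty\}$ (the zero module has dimension $0$), and $\Omega M$ denotes the kernel of the projective cover of $M\in\mathrm{mod}(\Lambda)$. Notation. For a class $\mathcal{Z}\subseteq\mathrm{mod}(\Lambda)$ let $\mathrm{fin.dim}(\mathcal{Z}):=\sup\{\mathrm{pd}\,Z : Z\in\mathcal{Z},\ \mathrm{pd}\,Z<\infty\}$, and put $\mathrm{fin.dim}(\Lambda):=\mathrm{fin.dim}(\mathrm{mod}(\Lambda))$. Let $K$ be the abelian group generated by the iso-classes $[M]$, $M\in\mathrm{mod}(\Lambda)$, modulo the relations $[M]=[X]+[Y]$ for $M\simeq X\oplus Y$; let $\langle\mathcal{P}\rangle\subseteq K$ be the subgroup generated by the classes of the indecomposable projective modules, and let $\overline{L}:K/\langle\mathcal{P}\rangle\to K/\langle\mathcal{P}\rangle$ be the endomorphism induced by $[M]\mapsto[\Omega M]$. For $X\in\mathrm{mod}(\Lambda)$ let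 $\overline{\langle X\rangle}\subseteq K/\langle\mathcal{P}\rangle$ be the subgroup generated by the images of the classes of the indecomposable modules in $\mathrm{add}(X)$, where $\mathrm{add}(X)$ is the class of direct summands of finite direct sums of copies of $X$. The Igusa-Todorov functions are $$\Phi(X):=\min\{k\in\mathbb{N} : \overline{L}\text{ restricts to an isomorphism }\overline{L}^m(\overline{\langle X\rangle})\to\overline{L}^{m+1}(\overline{\langle X\rangle})\text{ for all } m\ge k\},$$ $$\Psi(X):=\Phi(X)+\mathrm{fin.dim}(\{Z : Z\text{ is a direct summand of }\Omega^{\Phi(X)}X\}),$$ and $\Phi\mathrm{dim}(\Lambda):=\sup_{X}\Phi(X)$, $\Psi\mathrm{dim}(\Lambda):=\sup_{X}\Psi(X)$, where $X$ runs over $\mathrm{mod}(\Lambda)$. A module $M\in\mathrm{mod}(\Lambda)$ is Gorenstein projective if $M\simeq\mathrm{Ker}(d_0)$ for some acyclic complex $(P_m,\ d_m:P_m\to P_{m-1})_{m\in\mathbb{Z}}$ of finitely generated projective $\Lambda$-modules such that $\mathrm{Hom}_\Lambda(P_\bullet,Q)$ is acyclic for every finitely generated projective $Q$. $\mathrm{Gpd}(M)$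 is the least $n$ such that there is an exact sequence $0\to G_n\to\cdots\to G_0\to M\to 0$ in $\mathrm{mod}(\Lambda)$ with all $G_i$ Gorenstein projective ($\infty$ if there is none). For a class $\mathcal{X}\subseteq\mathrm{mod}(\Lambda)$ put $\mathrm{Gpd}(\mathcal{X}):=\sup\{\mathrm{Gpd}(M): M\in\mathcal{X}\}$; $\mathrm{gl.Gpdim}(\Lambda):=\mathrm{Gpd}(\mathrm{mod}(\Lambda))$ and $\mathrm{fin.Gpdim}(\Lambda):=\sup\{\mathrm{Gpd}(M): M\in\mathrm{mod}(\Lambda),\ \mathrm{Gpd}(M)<\infty\}$. Theorem. (a) For every integer $n\ge 0$, $$\mathrm{fin.Gpdim}(\Lambda)=\mathrm{fin.dim}(\Lambda)\le\Phi\mathrm{dim}(\Lambda)\le\Psi\mathrm{dim}(\Lambda)\le\mathrm{Gpd}(\Omega^n(\mathrm{mod}(\Lambda)))+n,$$ where $\Omega^n(\mathrm{mod}(\Lambda))=\{\Omega^nM : M\in\mathrm{mod}(\Lambda)\}$. (b) If $\mathrm{gl.Gpdim}(\Lambda)<\infty$, then $$\mathrm{fin.dim}(\Lambda)=\Phi\mathrm{dim}(\Lambda)=\Psi\mathrm{dim}(\Lambda)=\mathrm{gl.Gpdim}(\Lambda)\le\mathrm{id}({}_\Lambda\Lambda),$$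 where $\mathrm{id}({}_\Lambda\Lambda)$ is the injective dimension of $\Lambda$ as a left module over itself. -/

import Mathlib

universe u v

namespace IgusaTodorov

open CategoryTheory

/-! ### Artin algebras -/

/-- A ring `Λ` is an Artin algebra if it is an algebra over some commutative artinian ring `R`
and is finitely generated as an `R`-module. -/
class IsArtinAlgebra (Λ : Type u) [Ring Λ] : Prop where
  exists_base : ∃ (R : Type u) (_ : CommRing R) (_ : IsArtinianRing R) (_ : Algebra R Λ),
    Module.Finite R Λ

/-- The base ring may live in any universe: it can be replaced by the center of `Λ`. -/
theorem IsArtinAlgebra.of_algebra (R : Type v) (Λ : Type u) [CommRing R] [IsArtinianRing R]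
    [Ring Λ] [Algebra R Λ] [Module.Finite R Λ] : IsArtinAlgebra Λ := by
  have h : Module.Finite R (Subalgebra.center R Λ) :=
    Module.Finite.of_injective (Subalgebra.center R Λ).val.toLinearMap Subtype.val_injective
  let C := Subalgebra.center R Λ
  let _ : Algebra C Λ := C.val.toRingHom.toAlgebra'
    fun c x => (Subalgebra.mem_center_iff.1 c.2 x).symm
  have : IsScalarTower R C Λ := IsScalarTower.of_algebraMap_eq fun _ => rfl
  exact ⟨⟨C, inferInstance, IsArtinianRing.of_finite R C, inferInstance,
    Module.Finite.of_restrictScalars_finite R C Λ⟩⟩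

instance (priority := 100) IsArtinAlgebra.isArtinianRing (Λ : Type u) [Ring Λ]
    [h : IsArtinAlgebra Λ] : IsArtinianRing Λ := by
  obtain ⟨R, _, _, _, _⟩ := h.exists_base
  exact IsArtinianRing.of_finite R Λ

/-! ### Projective covers and syzygies -/

section ProjectiveCover

variable {Λ : Type u} [Ring Λ]

/-- A submodule `K` of `P` is superfluous (small) if `N + K = P` forces `N = P`. -/
def IsSuperfluous {P : Type*} [AddCommGroup P] [Module Λ P] (K : Submodule Λ P) : Prop :=
  ∀ N : Submodule Λ P, N ⊔ K = ⊤ → N = ⊤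

/-- A projective cover: an epimorphism from a projective module with superfluous kernel. -/
structure IsProjectiveCover {P M : Type*} [AddCommGroup P] [Module Λ P]
    [AddCommGroup M] [Module Λ M] (f : P →ₗ[Λ] M) : Prop where
  projective : Module.Projective Λ P
  surjective : Function.Surjective f
  superfluous : IsSuperfluous (LinearMap.ker f)

theorem IsSuperfluous.map {P Q : Type*} [AddCommGroup P] [Module Λ P] [AddCommGroup Q]
    [Module Λ Q] {K : Submodule Λ P} (hK : IsSuperfluous K) (φ : P →ₗ[Λ] Q) :
    IsSuperfluous (K.map φ) := by
  intro N hN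
  have h1 : N.comap φ ⊔ K = ⊤ := by
    refine eq_top_iff.2 fun p _ => ?_
    have hp : φ p ∈ N ⊔ K.map φ := by rw [hN]; trivial
    obtain ⟨n, hn, q, ⟨k, hk, rfl⟩, hnq⟩ := Submodule.mem_sup.1 hp
    refine Submodule.mem_sup.2 ⟨p - k, ?_, k, hk, by simp⟩
    simpa [← hnq] using hn
  have h2 := hK _ h1
  have h3 : K.map φ ≤ N := by
    rintro _ ⟨k, -, rfl⟩
    have : k ∈ N.comap φ := by rw [h2]; trivial
    exact this
  rwa [sup_eq_left.2 h3] at hN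

theorem IsSuperfluous.sup {P : Type*} [AddCommGroup P] [Module Λ P] {A B : Submodule Λ P}
    (hA : IsSuperfluous A) (hB : IsSuperfluous B) : IsSuperfluous (A ⊔ B) := by
  intro N hN
  exact hA N (hB _ (by rwa [sup_assoc]))

theorem IsProjectiveCover.prodMap {P M Q N : Type*} [AddCommGroup P] [Module Λ P]
    [AddCommGroup M] [Module Λ M] [AddCommGroup Q] [Module Λ Q] [AddCommGroup N] [Module Λ N]
    {f : P →ₗ[Λ] M} {g : Q →ₗ[Λ] N} (hf : IsProjectiveCover f) (hg : IsProjectiveCover g) :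
    IsProjectiveCover (f.prodMap g) := by
  have := hf.projective
  have := hg.projective
  refine ⟨inferInstance, ?_, ?_⟩
  · rintro ⟨m, n⟩
    obtain ⟨p, rfl⟩ := hf.surjective m
    obtain ⟨q, rfl⟩ := hg.surjective n
    exact ⟨(p, q), rfl⟩
  · have h : LinearMap.ker (f.prodMap g) =
        (LinearMap.ker f).map (LinearMap.inl Λ P Q) ⊔
          (LinearMap.ker g).map (LinearMap.inr Λ P Q) := by
      rw [LinearMap.ker_prodMap, Submodule.map_inl, Submodule.map_inr]
      simp [Submodule.prod_sup_prod]
    rw [h]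
    exact (hf.superfluous.map _).sup (hg.superfluous.map _)

/-- Projective covers of isomorphic modules have isomorphic kernels. -/
theorem IsProjectiveCover.ker_equiv {P M Q N : Type*} [AddCommGroup P] [Module Λ P]
    [AddCommGroup M] [Module Λ M] [AddCommGroup Q] [Module Λ Q] [AddCommGroup N] [Module Λ N]
    {f : P →ₗ[Λ] M} {g : Q →ₗ[Λ] N} (hf : IsProjectiveCover f) (hg : IsProjectiveCover g)
    (e : M ≃ₗ[Λ] N) : Nonempty (LinearMap.ker f ≃ₗ[Λ] LinearMap.ker g) := by
  have := hf.projective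
  have := hg.projective
  obtain ⟨h, hh⟩ := Module.projective_lifting_property g (e.toLinearMap ∘ₗ f) hg.surjective
  have hh' : ∀ p, g (h p) = e (f p) := fun p => LinearMap.congr_fun hh p
  have h_surj : Function.Surjective h := by
    rw [← LinearMap.range_eq_top]
    refine hg.superfluous _ (eq_top_iff.2 fun q _ => ?_)
    obtain ⟨p, hp⟩ := hf.surjective (e.symm (g q))
    refine Submodule.mem_sup.2 ⟨h p, ⟨p, rfl⟩, q - h p, ?_, by simp⟩
    simp [hh', hp]
  obtain ⟨s, hs⟩ := Module.projective_lifting_property h LinearMap.id h_surj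
  have hs' : ∀ q, h (s q) = q := fun q => LinearMap.congr_fun hs q
  have s_surj : Function.Surjective s := by
    rw [← LinearMap.range_eq_top]
    refine hf.superfluous _ (eq_top_iff.2 fun p _ => ?_)
    refine Submodule.mem_sup.2 ⟨s (h p), ⟨h p, rfl⟩, p - s (h p), ?_, by simp⟩
    have h1 : e (f (s (h p))) = e (f p) := by rw [← hh', hs', hh']
    simp [e.injective h1]
  have h_inj : Function.Injective h := by
    intro a b hab
    obtain ⟨a, rfl⟩ := s_surj a
    obtain ⟨b, rfl⟩ := s_surj b
    rw [hs', hs'] at hab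
    rw [hab]
  have hk : (LinearMap.ker f).map (LinearEquiv.ofBijective h ⟨h_inj, h_surj⟩ : P →ₗ[Λ] Q) =
      LinearMap.ker g := by
    ext q
    constructor
    · rintro ⟨p, hp, rfl⟩
      have hp' : f p = 0 := hp
      change g (h p) = 0
      rw [hh', hp', map_zero]
    · intro hq
      obtain ⟨p, rfl⟩ := h_surj q
      refine ⟨p, ?_, rfl⟩
      have hq' : g (h p) = 0 := hq
      rw [hh'] at hq'
      exact (LinearEquiv.map_eq_zero_iff e).1 hq'
  exact ⟨((LinearEquiv.ofBijective h ⟨h_inj, h_surj⟩).submoduleMap _).trans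
    (LinearEquiv.ofEq _ _ hk)⟩

/-- Over a left artinian ring every finitely generated module has a projective cover. -/
theorem exists_isProjectiveCover [IsArtinianRing Λ] (M : FGModuleCat.{u} Λ) :
    ∃ (P : FGModuleCat.{u} Λ) (f : P →ₗ[Λ] M), IsProjectiveCover f := by
  obtain ⟨n, π, hπ⟩ := Module.Finite.exists_fin' Λ M
  let S : Set (Submodule Λ (Fin n → Λ)) := {N | Module.Projective Λ N ∧ N.map π = ⊤}
  have hS : S.Nonempty := by
    refine ⟨⊤, Module.Projective.of_equiv (Submodule.topEquiv (R := Λ) (M := Fin n → Λ)).symm, ?_⟩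
    rw [Submodule.map_top, LinearMap.range_eq_top]
    exact hπ
  obtain ⟨N, ⟨hNproj, hNtop⟩, hNmin⟩ := WellFounded.has_min
    (wellFounded_lt (α := Submodule Λ (Fin n → Λ))) S hS
  let f : N →ₗ[Λ] M := π.domRestrict N
  have hf : Function.Surjective f := by
    intro m
    have : m ∈ N.map π := by rw [hNtop]; trivial
    obtain ⟨x, hx, rfl⟩ := this
    exact ⟨⟨x, hx⟩, rfl⟩
  refine ⟨FGModuleCat.of Λ N, f, hNproj, hf, fun N' hN' => ?_⟩
  -- lift `f` through the surjection `N' → M` to an endomorphism `g` of `N` with range in `N'`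
  have hf' : Function.Surjective (f.domRestrict N') := by
    intro m
    obtain ⟨x, rfl⟩ := hf m
    have hx : x ∈ N' ⊔ LinearMap.ker f := by rw [hN']; trivial
    obtain ⟨a, ha, b, hb, rfl⟩ := Submodule.mem_sup.1 hx
    have hb' : f b = 0 := hb
    exact ⟨⟨a, ha⟩, by change f a = f (a + b); rw [map_add, hb', add_zero]⟩
  obtain ⟨g₀, hg₀⟩ := Module.projective_lifting_property (f.domRestrict N') f hf'
  let g : Module.End Λ N := N'.subtype ∘ₗ g₀
  have hg : ∀ x, f (g x) = f x := fun x => LinearMap.congr_fun hg₀ x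
  have hgk : ∀ (k : ℕ) (x : N), f ((g ^ k) x) = f x := by
    intro k
    induction k with
    | zero => intro x; simp
    | succ k ih => intro x; rw [pow_succ', Module.End.mul_apply, hg, ih]
  obtain ⟨k, hk⟩ := Filter.eventually_atTop.1 g.eventually_isCompl_ker_pow_range_pow
  have hc := hk (k + 1) (by omega)
  let I : Submodule Λ N := LinearMap.range (g ^ (k + 1))
  have hIproj : Module.Projective Λ I :=
    Module.Projective.of_split I.subtype (Submodule.projectionOnto _ _ hc.symm)
      (by ext x; simp [I])
  have hI : I = ⊤ := by
    have hmem : I.map N.subtype ∈ S := by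
      refine ⟨Module.Projective.of_equiv (Submodule.equivMapOfInjective _ N.injective_subtype I),
        eq_top_iff.2 fun m _ => ?_⟩
      obtain ⟨x, rfl⟩ := hf m
      exact ⟨_, ⟨_, ⟨x, rfl⟩, rfl⟩, hgk (k + 1) x⟩
    have hle : I.map N.subtype ≤ N := Submodule.map_subtype_le N I
    have heq : I.map N.subtype = N := by
      by_contra hne
      exact hNmin _ hmem (lt_of_le_of_ne hle hne)
    refine eq_top_iff.2 fun x _ => ?_
    have hx : (x : Fin n → Λ) ∈ I.map N.subtype := by rw [heq]; exact x.2
    obtain ⟨y, hy, hxy⟩ := hx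
    have : y = x := Subtype.ext hxy
    exact this ▸ hy
  refine eq_top_iff.2 fun x _ => ?_
  have hx : x ∈ I := by rw [hI]; trivial
  obtain ⟨y, rfl⟩ := hx
  rw [pow_succ', Module.End.mul_apply]
  exact (g₀ _).2

end ProjectiveCover

section Syzygy

variable {Λ : Type u} [Ring Λ] [IsArtinianRing Λ]

/-- The (chosen) projective cover of a finitely generated module. -/
noncomputable def coverObj (M : FGModuleCat.{u} Λ) : FGModuleCat.{u} Λ :=
  (exists_isProjectiveCover M).choose

/-- The (chosen) projective cover map. -/
noncomputable def coverMap (M : FGModuleCat.{u} Λ) : coverObj M →ₗ[Λ] M :=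
  (exists_isProjectiveCover M).choose_spec.choose

theorem coverMap_isProjectiveCover (M : FGModuleCat.{u} Λ) : IsProjectiveCover (coverMap M) :=
  (exists_isProjectiveCover M).choose_spec.choose_spec

/-- The syzygy `Ω M`: the kernel of the projective cover of `M`. -/
noncomputable def syzygy (M : FGModuleCat.{u} Λ) : FGModuleCat.{u} Λ :=
  FGModuleCat.of Λ (LinearMap.ker (coverMap M))

theorem syzygy_prod {M X Y : FGModuleCat.{u} Λ} (e : M ≃ₗ[Λ] (X × Y)) :
    Nonempty (syzygy M ≃ₗ[Λ] (syzygy X × syzygy Y)) := by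
  obtain ⟨e₁⟩ := (coverMap_isProjectiveCover M).ker_equiv
    ((coverMap_isProjectiveCover X).prodMap (coverMap_isProjectiveCover Y)) e
  have h : LinearMap.ker ((coverMap X).prodMap (coverMap Y)) =
      (LinearMap.ker (coverMap X)).prod (LinearMap.ker (coverMap Y)) := LinearMap.ker_prodMap _ _
  exact ⟨e₁.trans ((LinearEquiv.ofEq _ _ h).trans
    { toFun := fun z => (⟨z.1.1, z.2.1⟩, ⟨z.1.2, z.2.2⟩)
      invFun := fun z => ⟨(z.1.1, z.2.1), z.1.2, z.2.2⟩
      map_add' := fun _ _ => rfl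
      map_smul' := fun _ _ => rfl
      left_inv := fun _ => rfl
      right_inv := fun _ => rfl })⟩

theorem syzygy_subsingleton (M : FGModuleCat.{u} Λ) (hM : Module.Projective Λ M) :
    Subsingleton (syzygy M) := by
  have hid : IsProjectiveCover (LinearMap.id : M →ₗ[Λ] M) :=
    ⟨hM, Function.surjective_id, fun N hN => by simpa using hN⟩
  obtain ⟨e⟩ := (coverMap_isProjectiveCover M).ker_equiv hid (LinearEquiv.refl Λ M)
  have : Subsingleton (LinearMap.ker (LinearMap.id : M →ₗ[Λ] M)) := by
    rw [LinearMap.ker_id]; infer_instance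
  exact e.toEquiv.subsingleton

end Syzygy

/-! ### Homological dimensions -/

section Dimensions

variable {Λ : Type u} [Ring Λ]

/-- The projective dimension of `M`: the least natural number `n` with `pd M ≤ n`, or `∞`.
The zero module has projective dimension `0`. -/
noncomputable def pd (M : FGModuleCat.{u} Λ) : ℕ∞ :=
  ⨅ (n : ℕ) (_ : HasProjectiveDimensionLE M.obj n), (n : ℕ∞)

/-- The injective dimension of `M`: the least natural number `n` with `id M ≤ n`, or `∞`.
The zero module has injective dimension `0`. -/
noncomputable def injDim (M : FGModuleCat.{u} Λ) : ℕ∞ :=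
  ⨅ (n : ℕ) (_ : HasInjectiveDimensionLE M.obj n), (n : ℕ∞)

/-- The finitistic dimension of a class of modules. -/
noncomputable def finDimClass (X : Set (FGModuleCat.{u} Λ)) : ℕ∞ :=
  ⨆ (M : FGModuleCat.{u} Λ) (_ : M ∈ X) (_ : pd M < ⊤), pd M

variable (Λ) in
/-- The finitistic dimension `fin.dim Λ`. -/
noncomputable def finDim : ℕ∞ :=
  finDimClass (Set.univ : Set (FGModuleCat.{u} Λ))

/-- `HasResolution X n M`: there is an exact sequence `0 → X_n → ⋯ → X_1 → X_0 → M → 0` with all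
`X_i` in the class `X`, cut into short exact sequences. -/
def HasResolution (X : Set (FGModuleCat.{u} Λ)) : ℕ → FGModuleCat.{u} Λ → Prop
  | 0, M => ∃ X₀ ∈ X, Nonempty (X₀ ≃ₗ[Λ] M)
  | n + 1, M => ∃ X₀ ∈ X, ∃ (N : FGModuleCat.{u} Λ) (i : N →ₗ[Λ] X₀) (p : X₀ →ₗ[Λ] M),
      Function.Injective i ∧ Function.Exact i p ∧ Function.Surjective p ∧ HasResolution X n N

/-- The resolution dimension of `M` relative to the class `X`. -/
noncomputable def resdim (X : Set (FGModuleCat.{u} Λ)) (M : FGModuleCat.{u} Λ) : ℕ∞ :=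
  ⨅ (n : ℕ) (_ : HasResolution X n M), (n : ℕ∞)

/-- `M` is Gorenstein projective: it is isomorphic to the kernel of the differential in degree `0`
of an acyclic complex `⋯ → P 1 → P 0 → P (-1) → ⋯` of finitely generated projective modules that
stays acyclic under `Hom(-, Q)` for every finitely generated projective `Q`. Here `d m` is the
differential `P (m + 1) → P m`, so the one leaving degree `0` is `d (-1)`. -/
def IsGorensteinProjective (M : FGModuleCat.{u} Λ) : Prop :=
  ∃ (P : ℤ → FGModuleCat.{u} Λ) (d : ∀ m : ℤ, P (m + 1) →ₗ[Λ] P m),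
    (∀ m, Module.Projective Λ (P m)) ∧
    (∀ m, Function.Exact (d (m + 1)) (d m)) ∧
    (∀ Q : FGModuleCat.{u} Λ, Module.Projective Λ Q → ∀ m,
      Function.Exact (fun h : P m →ₗ[Λ] Q => h ∘ₗ d m)
        (fun h : P (m + 1) →ₗ[Λ] Q => h ∘ₗ d (m + 1))) ∧
    Nonempty (M ≃ₗ[Λ] LinearMap.ker (d (-1)))

variable (Λ) in
/-- The class `Gproj Λ` of finitely generated Gorenstein projective modules. -/
def Gproj : Set (FGModuleCat.{u} Λ) := {M | IsGorensteinProjective M}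

/-- The Gorenstein projective dimension of `M`. -/
noncomputable def Gpd (M : FGModuleCat.{u} Λ) : ℕ∞ := resdim (Gproj Λ) M

/-- The Gorenstein projective dimension of a class of modules. -/
noncomputable def GpdClass (X : Set (FGModuleCat.{u} Λ)) : ℕ∞ :=
  ⨆ (M : FGModuleCat.{u} Λ) (_ : M ∈ X), Gpd M

variable (Λ) in
/-- The global Gorenstein projective dimension `gl.Gpdim Λ`. -/
noncomputable def glGpdim : ℕ∞ := GpdClass (Set.univ : Set (FGModuleCat.{u} Λ))

variable (Λ) in
/-- The finitistic Gorenstein projective dimension `fin.Gpdim Λ`: the supremum over the modules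
which have a finite resolution by Gorenstein projective modules. -/
noncomputable def finGpdim : ℕ∞ := GpdClass {M : FGModuleCat.{u} Λ | Gpd M < ⊤}

variable (Λ) in
/-- The class `Ωⁿ(mod Λ)` of `n`-th syzygies of finitely generated modules. -/
def syzygyClass [IsArtinianRing Λ] (n : ℕ) : Set (FGModuleCat.{u} Λ) :=
  Set.range (syzygy (Λ := Λ))^[n]

end Dimensions

/-! ### The Igusa-Todorov functions -/

section IgusaTodorovFunctions

variable {Λ : Type u} [Ring Λ]

/-- `Z` is a direct summand of `M`. -/
def IsSummand (Z M : FGModuleCat.{u} Λ) : Prop :=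
  ∃ Z' : FGModuleCat.{u} Λ, Nonempty (M ≃ₗ[Λ] (Z × Z'))

/-- `add M`: the direct summands of finite direct sums of copies of `M`. -/
def addClosure (M : FGModuleCat.{u} Λ) : Set (FGModuleCat.{u} Λ) :=
  {Z | ∃ s : ℕ, IsSummand Z (FGModuleCat.of Λ (Fin s → M))}

/-- `M` is indecomposable: nonzero, and not a direct sum of two nonzero modules. -/
def IsIndecomposable (M : FGModuleCat.{u} Λ) : Prop :=
  ¬ Subsingleton M ∧ ∀ X Y : FGModuleCat.{u} Λ, Nonempty (M ≃ₗ[Λ] (X × Y)) →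
    Subsingleton X ∨ Subsingleton Y

variable (Λ) in
/-- The subgroup generated by the elements `[M] - [X] - [Y]` with `M ≃ X ⊕ Y`. -/
def splitRelations : AddSubgroup (FreeAbelianGroup (FGModuleCat.{u} Λ)) :=
  AddSubgroup.closure {z | ∃ M X Y : FGModuleCat.{u} Λ, Nonempty (M ≃ₗ[Λ] (X × Y)) ∧
    z = FreeAbelianGroup.of M - FreeAbelianGroup.of X - FreeAbelianGroup.of Y}

variable (Λ) in
/-- The group `K`: the abelian group generated by finitely generated modules modulo
`[M] = [X] + [Y]` for `M ≃ X ⊕ Y`. These relations identify isomorphic modules. -/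
abbrev KGroup : Type (u + 1) := FreeAbelianGroup (FGModuleCat.{u} Λ) ⧸ splitRelations Λ

/-- The class `[M]` of a module in `K`. -/
def cls (M : FGModuleCat.{u} Λ) : KGroup Λ :=
  QuotientAddGroup.mk' (splitRelations Λ) (FreeAbelianGroup.of M)

theorem cls_prod {M X Y : FGModuleCat.{u} Λ} (e : M ≃ₗ[Λ] (X × Y)) :
    cls M = cls X + cls Y := by
  have h : FreeAbelianGroup.of M - FreeAbelianGroup.of X - FreeAbelianGroup.of Y ∈
      splitRelations Λ := AddSubgroup.subset_closure ⟨M, X, Y, ⟨e⟩, rfl⟩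
  have h' := (QuotientAddGroup.eq_zero_iff _).2 h
  have h'' : cls M - cls X - cls Y = 0 := h'
  rwa [sub_sub, sub_eq_zero] at h''

theorem cls_eq_zero (M : FGModuleCat.{u} Λ) [Subsingleton M] : cls M = 0 := by
  have h := cls_prod (M := M) (X := M) (Y := M)
    { toFun := fun x => (x, x)
      invFun := fun x => x.1
      map_add' := fun _ _ => rfl
      map_smul' := fun _ _ => rfl
      left_inv := fun _ => rfl
      right_inv := fun _ => Subsingleton.elim _ _ }
  exact left_eq_add.1 h

/-- Isomorphic modules have the same class in `K`. -/
theorem cls_eq_of_equiv {M N : FGModuleCat.{u} Λ} (e : M ≃ₗ[Λ] N) : cls M = cls N := by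
  have h := cls_prod (M := M) (X := N) (Y := FGModuleCat.of Λ PUnit.{u + 1})
    (e.trans (LinearEquiv.prodUnique (R := Λ) (M := N) (M₂ := PUnit.{u + 1})).symm)
  have : Subsingleton (FGModuleCat.of Λ PUnit.{u + 1}) :=
    inferInstanceAs (Subsingleton PUnit.{u + 1})
  rwa [cls_eq_zero (FGModuleCat.of Λ PUnit.{u + 1}), add_zero] at h

/-- The subgroup `⟨X⟩` of `K` generated by the classes of the indecomposable modules that lie in
the class `X` or are projective. -/
def gen (X : Set (FGModuleCat.{u} Λ)) : AddSubgroup (KGroup Λ) :=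
  AddSubgroup.closure {z | ∃ M : FGModuleCat.{u} Λ, IsIndecomposable M ∧
    (M ∈ X ∨ Module.Projective Λ M) ∧ z = cls M}

variable (Λ) in
/-- The class of finitely generated projective modules. -/
def projClass : Set (FGModuleCat.{u} Λ) := {M | Module.Projective Λ M}

variable (Λ) in
/-- The quotient group `K / ⟨𝒫⟩`. -/
abbrev KProj : Type (u + 1) := KGroup Λ ⧸ gen (projClass Λ)

variable [IsArtinianRing Λ]

variable (Λ) in
/-- The endomorphism `L : K → K`, `[M] ↦ [Ω M]`. -/
noncomputable def syzygyHom : KGroup Λ →+ KGroup Λ :=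
  QuotientAddGroup.map (splitRelations Λ) (splitRelations Λ)
    (FreeAbelianGroup.map (syzygy (Λ := Λ))) (by
      rw [splitRelations, AddSubgroup.closure_le]
      rintro _ ⟨M, X, Y, ⟨e⟩, rfl⟩
      refine AddSubgroup.subset_closure ⟨syzygy M, syzygy X, syzygy Y, syzygy_prod e, ?_⟩
      simp [FreeAbelianGroup.map_of_apply])

theorem syzygyHom_cls (M : FGModuleCat.{u} Λ) : syzygyHom Λ (cls M) = cls (syzygy M) := by
  simp [syzygyHom, cls, FreeAbelianGroup.map_of_apply]

variable (Λ) in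
/-- The endomorphism of `K / ⟨𝒫⟩` induced by `L`. -/
noncomputable def syzygyHomBar : KProj Λ →+ KProj Λ :=
  QuotientAddGroup.map (gen (projClass Λ)) (gen (projClass Λ)) (syzygyHom Λ) (by
    rw [gen, AddSubgroup.closure_le]
    rintro _ ⟨M, -, hM, rfl⟩
    have : Subsingleton (syzygy M) := syzygy_subsingleton M (hM.elim id id)
    change syzygyHom Λ (cls M) ∈ gen (projClass Λ)
    rw [syzygyHom_cls, cls_eq_zero]
    exact zero_mem _)

/-- The image of `⟨M⟩ = ⟨add M⟩` in `K / ⟨𝒫⟩`. -/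
def genBar (M : FGModuleCat.{u} Λ) : AddSubgroup (KProj Λ) :=
  (gen (addClosure M)).map (QuotientAddGroup.mk' (gen (projClass Λ)))

/-- `η_f(X)`: the least `k` such that `f` restricts to an isomorphism `f^m(X) → f^(m+1)(X)` for
all `m ≥ k`. For finitely generated `X` such a `k` exists by Fitting's lemma. -/
noncomputable def eta {A : Type*} [AddCommGroup A] (f : A →+ A) (X : AddSubgroup A) : ℕ :=
  sInf {k : ℕ | ∀ m ≥ k, Set.BijOn f (f^[m] '' X) (f^[m + 1] '' X)}

/-- The first Igusa-Todorov function. -/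
noncomputable def Phi (M : FGModuleCat.{u} Λ) : ℕ := eta (syzygyHomBar Λ) (genBar M)

/-- The second Igusa-Todorov function. -/
noncomputable def Psi (M : FGModuleCat.{u} Λ) : ℕ∞ :=
  Phi M + finDimClass {Z : FGModuleCat.{u} Λ | IsSummand Z (syzygy^[Phi M] M)}

variable (Λ) in
/-- The dimension `Φdim Λ`. -/
noncomputable def PhiDim : ℕ∞ := ⨆ M : FGModuleCat.{u} Λ, (Phi M : ℕ∞)

variable (Λ) in
/-- The dimension `Ψdim Λ`. -/
noncomputable def PsiDim : ℕ∞ := ⨆ M : FGModuleCat.{u} Λ, Psi M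

end IgusaTodorovFunctions

end IgusaTodorov

open IgusaTodorov

/-! The whole argument runs through one condition, `ExtVanish n M`: no extensions of `M` by
projective modules in degrees above `n`. It passes along short exact sequences and shifts by one
under each syzygy (`extVanish_iff_iterate_syzygy`). Among modules of finite projective dimension it
says exactly `pd M ≤ n` (`hasProjectiveDimensionLE_of_extVanish`), and among those of finite
Gorenstein projective dimension exactly `Gpd M ≤ n` (`Gpd_le_of_extVanish`).

A module with `Gpd M ≤ n` embeds in some `H` with `pd H ≤ n` and Gorenstein projective cokernel, and
conversely (`HasResolution.exists_embedding`, `hasResolution_of_embedding`). Thus every finite value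
of `Gpd` is a value of `pd`, and the two finitistic dimensions agree.

For the lower bound, the class of a module in `K / ⟨𝒫⟩` vanishes only if the module is projective.
If `pd M` is finite and positive, the syzygy operator therefore kills a nonzero class at step `pd M
- 1`, which forces `pd M ≤ Phi M`.

For the upper bound, suppose that `ExtVanish s` holds for all modules. Cokernels of left
approximations by projectives define an additive map on `K / ⟨𝒫⟩` that inverts the syzygy on classes
of modules with `ExtVanish 0` (`exists_cosyzygyHom`). Every syzygy from the `s`-th on is such a
module, so `Phi M ≤ s`. The summands of finite projective dimension in the `Phi M`-th syzygy then
have dimension at most `s - Phi M`, so `Psi M ≤ s`. A bound `m` on `Gpd` over `n`-th syzygies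
supplies `s = n + m`. Part (b) is the case `n = 0`, where the inequalities close into a cycle. -/

namespace IgusaTodorov

open CategoryTheory Abelian

/-! ### Short exact sequences and vanishing of extensions by projectives. -/

section ShortExact

variable {Λ : Type u} [Ring Λ]

/-- `0 → A → B → C → 0` is exact. -/
structure IsShortExact {A B C : FGModuleCat.{u} Λ} (i : A →ₗ[Λ] B) (p : B →ₗ[Λ] C) : Prop where
  injective : Function.Injective i
  exact : Function.Exact i p
  surjective : Function.Surjective p

/-- `A` is the kernel of an epimorphism from a finitely generated projective module to `C`. -/
def IsKernelOfPresentation (A C : FGModuleCat.{u} Λ) : Prop :=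
  ∃ (P : FGModuleCat.{u} Λ) (i : A →ₗ[Λ] P) (p : P →ₗ[Λ] C),
    Module.Projective Λ P ∧ IsShortExact i p

theorem IsShortExact.shortExact {A B C : FGModuleCat.{u} Λ} {i : A →ₗ[Λ] B} {p : B →ₗ[Λ] C}
    (h : IsShortExact i p) :
    (ShortComplex.mk (X₁ := A.obj) (X₂ := B.obj) (X₃ := C.obj) (ModuleCat.ofHom i)
      (ModuleCat.ofHom p)
      (ModuleCat.hom_ext (LinearMap.ext h.exact.apply_apply_eq_zero))).ShortExact :=
  ModuleCat.shortComplex_shortExact _ h.exact h.injective h.surjective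

/-- Maps that vanish on the kernel factor through the cokernel. -/
theorem IsShortExact.exists_factorization {A B C : FGModuleCat.{u} Λ} {i : A →ₗ[Λ] B}
    {p : B →ₗ[Λ] C} (h : IsShortExact i p) {N : Type*} [AddCommGroup N] [Module Λ N]
    (f : B →ₗ[Λ] N) (hf : f ∘ₗ i = 0) : ∃ g : C →ₗ[Λ] N, g ∘ₗ p = f := by
  have hker : LinearMap.ker p ≤ LinearMap.ker f := by
    intro x hx
    obtain ⟨a, rfl⟩ := (h.exact x).1 hx
    exact LinearMap.congr_fun hf a
  refine ⟨(LinearMap.ker p).liftQ f hker ∘ₗ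
    (p.quotKerEquivOfSurjective h.surjective).symm.toLinearMap, LinearMap.ext fun x => ?_⟩
  have : (p.quotKerEquivOfSurjective h.surjective).symm (p x) = (LinearMap.ker p).mkQ x := by
    rw [LinearEquiv.symm_apply_eq]; rfl
  simp [this]

theorem isShortExact_ker [IsNoetherianRing Λ] {B C : FGModuleCat.{u} Λ} {p : B →ₗ[Λ] C}
    (hp : Function.Surjective p) :
    IsShortExact (A := FGModuleCat.of Λ (LinearMap.ker p)) (LinearMap.ker p).subtype p :=
  ⟨Subtype.val_injective, LinearMap.exact_subtype_ker_map p, hp⟩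

theorem isShortExact_coker {A B : FGModuleCat.{u} Λ} {i : A →ₗ[Λ] B}
    (hi : Function.Injective i) :
    IsShortExact (C := FGModuleCat.of Λ (B ⧸ LinearMap.range i)) i (LinearMap.range i).mkQ :=
  ⟨hi, LinearMap.exact_map_mkQ_range i, Submodule.mkQ_surjective _⟩

instance projective_punit : Module.Projective Λ (FGModuleCat.of Λ PUnit.{u + 1}) :=
  inferInstanceAs (Module.Projective Λ PUnit.{u + 1})

theorem isShortExact_fin_succ (M : FGModuleCat.{u} Λ) (k : ℕ) :
    IsShortExact (A := M) (B := FGModuleCat.of Λ (Fin (k + 1) → M))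
      (C := FGModuleCat.of Λ (Fin k → M))
      ((Fin.consLinearEquiv Λ fun _ : Fin (k + 1) => M).toLinearMap ∘ₗ
        LinearMap.inl Λ M (Fin k → M))
      (LinearMap.snd Λ M (Fin k → M) ∘ₗ
        (Fin.consLinearEquiv Λ fun _ : Fin (k + 1) => M).symm.toLinearMap) := by
  set e := Fin.consLinearEquiv Λ fun _ : Fin (k + 1) => M
  refine ⟨e.injective.comp (LinearMap.inl_injective (R := Λ)), fun x => ⟨fun hx => ?_, ?_⟩,
    fun y => ⟨e (0, y), congrArg Prod.snd (e.symm_apply_apply (0, y))⟩⟩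
  · have hx' : (e.symm x).2 = 0 := hx
    refine ⟨(e.symm x).1, e.symm.injective ?_⟩
    change e.symm (e (_, _)) = _
    rw [e.symm_apply_apply]
    exact Prod.ext rfl hx'.symm
  · rintro ⟨y, rfl⟩
    change (e.symm (e (y, 0))).2 = 0
    rw [e.symm_apply_apply]

/-- `Extⁱ(M, Q) = 0` for all `i > n` and all finitely generated projective modules `Q`. -/
def ExtVanish (n : ℕ) (M : FGModuleCat.{u} Λ) : Prop :=
  ∀ Q : FGModuleCat.{u} Λ, Module.Projective Λ Q → ∀ i > n, ∀ x : Ext.{u} M.obj Q.obj i, x = 0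

theorem ExtVanish.mono {m n : ℕ} (hmn : m ≤ n) {M : FGModuleCat.{u} Λ} (h : ExtVanish m M) :
    ExtVanish n M :=
  fun Q hQ i hi => h Q hQ i (lt_of_le_of_lt hmn hi)

theorem ExtVanish.mid {A B C : FGModuleCat.{u} Λ} {i : A →ₗ[Λ] B} {p : B →ₗ[Λ] C}
    (h : IsShortExact i p) {n : ℕ} (hA : ExtVanish n A) (hC : ExtVanish n C) :
    ExtVanish n B := by
  intro Q hQ k hk x
  obtain ⟨y, rfl⟩ := Ext.contravariant_sequence_exact₂ h.shortExact Q.obj x (hA Q hQ k hk _)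
  rw [hC Q hQ k hk y, Ext.comp_zero]

theorem ExtVanish.left {A B C : FGModuleCat.{u} Λ} {i : A →ₗ[Λ] B} {p : B →ₗ[Λ] C}
    (h : IsShortExact i p) {n : ℕ} (hB : ExtVanish n B) (hC : ExtVanish (n + 1) C) :
    ExtVanish n A := by
  intro Q hQ k hk x
  obtain ⟨y, rfl⟩ := Ext.contravariant_sequence_exact₁ h.shortExact Q.obj x (add_comm 1 k)
    (hC Q hQ (k + 1) (by omega) _)
  rw [hB Q hQ k hk y, Ext.comp_zero]

theorem ExtVanish.right {A B C : FGModuleCat.{u} Λ} {i : A →ₗ[Λ] B} {p : B →ₗ[Λ] C}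
    (h : IsShortExact i p) {n : ℕ} (hA : ExtVanish n A) (hB : ExtVanish (n + 1) B) :
    ExtVanish (n + 1) C := by
  intro Q hQ k hk x
  obtain ⟨k, rfl⟩ : ∃ l, k = l + 1 := ⟨k - 1, by omega⟩
  obtain ⟨y, rfl⟩ := Ext.contravariant_sequence_exact₃ h.shortExact Q.obj x
    (hB Q hQ (k + 1) hk _) (add_comm 1 k)
  rw [hA Q hQ k (by omega) y, Ext.comp_zero]

theorem ExtVanish.of_hasProjectiveDimensionLE {n : ℕ} {M : FGModuleCat.{u} Λ}
    (h : HasProjectiveDimensionLE M.obj n) : ExtVanish n M :=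
  fun _ _ _ hi x => x.eq_zero_of_hasProjectiveDimensionLT (n + 1) hi

theorem hasProjectiveDimensionLE_zero_iff {M : FGModuleCat.{u} Λ} :
    HasProjectiveDimensionLE M.obj 0 ↔ Module.Projective Λ M :=
  (projective_iff_hasProjectiveDimensionLE_zero M.obj).symm.trans
    (IsProjective.iff_projective M).symm

theorem ExtVanish.of_projective {M : FGModuleCat.{u} Λ} (h : Module.Projective Λ M) :
    ExtVanish 0 M :=
  .of_hasProjectiveDimensionLE (hasProjectiveDimensionLE_zero_iff.2 h)

theorem ExtVanish.of_equiv {n : ℕ} {M N : FGModuleCat.{u} Λ} (e : M ≃ₗ[Λ] N)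
    (h : ExtVanish n M) : ExtVanish n N :=
  .left (⟨e.symm.injective, fun x => ⟨fun _ => ⟨e x, e.symm_apply_apply x⟩, fun _ => rfl⟩,
      fun _ => ⟨0, rfl⟩⟩ : IsShortExact (C := FGModuleCat.of Λ PUnit.{u + 1}) e.symm.toLinearMap 0)
    h ((ExtVanish.of_projective projective_punit).mono (Nat.zero_le _))

/-- Maps to projective modules extend along a monomorphism whose cokernel has no `Ext¹`. -/
theorem ExtVanish.exists_extension {A B C : FGModuleCat.{u} Λ} {i : A →ₗ[Λ] B} {p : B →ₗ[Λ] C}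
    (h : IsShortExact i p) (hC : ExtVanish 0 C) {Q : FGModuleCat.{u} Λ}
    (hQ : Module.Projective Λ Q) (φ : A →ₗ[Λ] Q) : ∃ ψ : B →ₗ[Λ] Q, ψ ∘ₗ i = φ := by
  let f : A.obj ⟶ Q.obj := ModuleCat.ofHom φ
  obtain ⟨y, hy⟩ := Ext.contravariant_sequence_exact₁ h.shortExact Q.obj (Ext.mk₀ f)
    (n₁ := 1) rfl (hC Q hQ 1 (by omega) _)
  obtain ⟨g, rfl⟩ := Ext.homEquiv₀.symm.surjective y
  refine ⟨g.hom, ?_⟩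
  have : ModuleCat.ofHom i ≫ g = f := Ext.homEquiv₀.symm.injective (by simpa using hy)
  exact congrArg ModuleCat.Hom.hom this

/-- Since `P` is projective, every element of `Ext¹(C, Q)` is the connecting image of a map `A → Q`,
and the connecting map kills whatever extends to `P`. This is the converse to
`ExtVanish.exists_extension`. -/
theorem ext_one_eq_zero_of_exists_extension {A P C : FGModuleCat.{u} Λ} {i : A →ₗ[Λ] P}
    {p : P →ₗ[Λ] C} (h : IsShortExact i p) (hP : Module.Projective Λ P)
    (Q : FGModuleCat.{u} Λ)
    (H : ∀ φ : A →ₗ[Λ] Q, ∃ ψ : P →ₗ[Λ] Q, ψ ∘ₗ i = φ) (x : Ext.{u} C.obj Q.obj 1) : x = 0 := by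
  have := hasProjectiveDimensionLE_zero_iff.2 hP
  obtain ⟨y, rfl⟩ := Ext.contravariant_sequence_exact₃ h.shortExact Q.obj x
    (Ext.eq_zero_of_hasProjectiveDimensionLT _ 1 le_rfl) (n₀ := 0) rfl
  obtain ⟨g, rfl⟩ := Ext.homEquiv₀.symm.surjective y
  obtain ⟨ψ, hψ⟩ := H g.hom
  have : g = ModuleCat.ofHom i ≫ (ModuleCat.ofHom ψ : P.obj ⟶ Q.obj) :=
    ModuleCat.hom_ext hψ.symm
  have h0 : Ext.homEquiv₀.symm g = (Ext.mk₀ (ModuleCat.ofHom i)).comp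
      (Ext.mk₀ (ModuleCat.ofHom ψ : P.obj ⟶ Q.obj)) (zero_add 0) := by
    rw [Ext.mk₀_comp_mk₀, ← this]; rfl
  rw [h0]
  exact h.shortExact.extClass_comp_assoc (Ext.mk₀ (ModuleCat.ofHom ψ : P.obj ⟶ Q.obj))

end ShortExact

/-! ### Projective dimension detected by extensions. -/

section ProjectiveDimension

variable {Λ : Type u} [Ring Λ]

theorem hasProjectiveDimensionLE_succ_iff {A P C : FGModuleCat.{u} Λ} {i : A →ₗ[Λ] P}
    {p : P →ₗ[Λ] C} (h : IsShortExact i p) (hP : Module.Projective Λ P) (n : ℕ) :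
    HasProjectiveDimensionLE C.obj (n + 1) ↔ HasProjectiveDimensionLE A.obj n :=
  h.shortExact.hasProjectiveDimensionLT_X₃_iff n ((IsProjective.iff_projective P).1 hP)

theorem hasProjectiveDimensionLE_mono {M : FGModuleCat.{u} Λ} {m n : ℕ} (hmn : m ≤ n)
    (h : HasProjectiveDimensionLE M.obj m) : HasProjectiveDimensionLE M.obj n :=
  hasProjectiveDimensionLT_of_ge M.obj (m + 1) (n + 1) (by omega)

theorem IsSummand.hasProjectiveDimensionLE {Z M : FGModuleCat.{u} Λ} (hZ : IsSummand Z M) {n : ℕ}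
    (h : HasProjectiveDimensionLE M.obj n) : HasProjectiveDimensionLE Z.obj n := by
  obtain ⟨Z', ⟨e⟩⟩ := hZ
  let r : Retract Z.obj M.obj :=
    { i := ModuleCat.ofHom (e.symm.toLinearMap ∘ₗ LinearMap.inl Λ Z Z')
      r := ModuleCat.ofHom (LinearMap.fst Λ Z Z' ∘ₗ e.toLinearMap)
      retract := by ext x; simp }
  exact r.hasProjectiveDimensionLT (n + 1)

theorem IsSummand.extVanish {Z M : FGModuleCat.{u} Λ} (hZ : IsSummand Z M) {n : ℕ}
    (h : ExtVanish n M) : ExtVanish n Z := by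
  obtain ⟨Z', ⟨e⟩⟩ := hZ
  intro Q hQ k hk x
  let i : Z.obj ⟶ M.obj := ModuleCat.ofHom (e.symm.toLinearMap ∘ₗ LinearMap.inl Λ Z Z')
  let r : M.obj ⟶ Z.obj := ModuleCat.ofHom (LinearMap.fst Λ Z Z' ∘ₗ e.toLinearMap)
  have hir : i ≫ r = 𝟙 _ := by ext x; simp [i, r]
  rw [← Ext.mk₀_id_comp x, ← hir, ← Ext.mk₀_comp_mk₀_assoc,
    h Q hQ k hk ((Ext.mk₀ r).comp x (zero_add k)), Ext.comp_zero]

variable [IsNoetherianRing Λ]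

theorem exists_isKernelOfPresentation (M : FGModuleCat.{u} Λ) :
    ∃ A, IsKernelOfPresentation A M := by
  obtain ⟨n, π, hπ⟩ := Module.Finite.exists_fin' Λ M
  exact ⟨_, FGModuleCat.of Λ (Fin n → Λ), _, π,
    inferInstanceAs (Module.Projective Λ (Fin n → Λ)), isShortExact_ker hπ⟩

/-- If `pd M` is finite, then it is detected by `Ext` into projective modules. -/
theorem hasProjectiveDimensionLE_of_extVanish {n : ℕ} : ∀ {k : ℕ} {M : FGModuleCat.{u} Λ},
    HasProjectiveDimensionLE M.obj k → ExtVanish n M → HasProjectiveDimensionLE M.obj n := by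
  induction n with
  | zero =>
    intro k
    induction k with
    | zero => exact fun h _ => h
    | succ k ih =>
      intro M hM hE
      obtain ⟨A, P, i, p, hP, h⟩ := exists_isKernelOfPresentation M
      have hA : HasProjectiveDimensionLE A.obj 0 :=
        ih ((hasProjectiveDimensionLE_succ_iff h hP k).1 hM)
          (.left h (.of_projective hP) (hE.mono (Nat.zero_le 1)))
      -- `A` is itself projective, so its identity extends to `P`. The retraction `r` splits the
      -- sequence, and `id - i ∘ r` descends to a section `s` of `p`.
      obtain ⟨r, hr⟩ := hE.exists_extension h (hasProjectiveDimensionLE_zero_iff.1 hA) LinearMap.id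
      have hi : ∀ x, r (i x) = x := fun x => LinearMap.congr_fun hr x
      obtain ⟨s, hs⟩ := h.exists_factorization (LinearMap.id - i ∘ₗ r)
        (LinearMap.ext fun x => by simp [hi])
      have hs' : p ∘ₗ s = LinearMap.id := LinearMap.ext fun m => by
        obtain ⟨x, rfl⟩ := h.surjective m
        have : s (p x) = x - i (r x) := LinearMap.congr_fun hs x
        simp [this, h.exact.apply_apply_eq_zero]
      exact hasProjectiveDimensionLE_zero_iff.2 (Module.Projective.of_split s p hs')
  | succ n ih =>
    intro k M hM hE
    obtain ⟨A, P, i, p, hP, h⟩ := exists_isKernelOfPresentation M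
    rw [hasProjectiveDimensionLE_succ_iff h hP]
    exact ih (k := k) ((hasProjectiveDimensionLE_succ_iff h hP k).1
        (hasProjectiveDimensionLE_mono (Nat.le_succ k) hM))
      (.left h ((ExtVanish.of_projective hP).mono (Nat.zero_le _)) hE)

end ProjectiveDimension

/-! ### Injective dimension of the regular module. -/

section InjectiveDimension

variable {Λ : Type u} [Ring Λ]

/-- Finitely generated projectives are retracts of finite powers of `Λ`, and the bound on injective
dimension passes to powers and retracts. -/
theorem ExtVanish.of_hasInjectiveDimensionLE {n : ℕ}
    (h : HasInjectiveDimensionLE (FGModuleCat.of Λ Λ).obj n) (M : FGModuleCat.{u} Λ) :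
    ExtVanish n M := by
  have hpow : ∀ k : ℕ, HasInjectiveDimensionLE (FGModuleCat.of Λ (Fin k → Λ)).obj n := by
    intro k
    induction k with
    | zero =>
      have : Limits.IsZero (FGModuleCat.of Λ (Fin 0 → Λ)).obj :=
        @ModuleCat.isZero_of_subsingleton _ _ _ (inferInstanceAs (Subsingleton (Fin 0 → Λ)))
      have := this.hasInjectiveDimensionLT_zero
      exact hasInjectiveDimensionLT_of_ge _ 0 (n + 1) (Nat.zero_le _)
    | succ k ih =>
      exact (isShortExact_fin_succ (FGModuleCat.of Λ Λ) k).shortExact.hasInjectiveDimensionLT_X₂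
        (n + 1) h ih
  intro Q hQ k hk x
  obtain ⟨m, f, g, -, -, hfg⟩ := Module.Finite.exists_comp_eq_id_of_projective Λ Q
  have := hpow m
  let r : Retract Q.obj (FGModuleCat.of Λ (Fin m → Λ)).obj :=
    { i := ModuleCat.ofHom g
      r := ModuleCat.ofHom f
      retract := ModuleCat.hom_ext hfg }
  have := r.hasInjectiveDimensionLT (n + 1)
  exact x.eq_zero_of_hasInjectiveDimensionLT (n + 1) hk

end InjectiveDimension

/-! ### Gorenstein projective modules as two-sided chains of syzygies. -/

section GorensteinProjective

variable {Λ : Type u} [Ring Λ]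

theorem IsKernelOfPresentation.extVanish {A C : FGModuleCat.{u} Λ}
    (h : IsKernelOfPresentation A C) (hC : ExtVanish 0 C) : ExtVanish 0 A := by
  obtain ⟨P, i, p, hP, h⟩ := h
  exact .left h (.of_projective hP) (hC.mono (Nat.zero_le 1))

/-- Dimension shifting moves an extension of `Z m` in degree `k + 1` to one of `Z (m + 1)` in degree
`k`. In degree one, the extension property of the embeddings concludes. -/
theorem extVanish_of_chain (Z : ℤ → FGModuleCat.{u} Λ)
    (hZ : ∀ m, ∃ (P : FGModuleCat.{u} Λ) (i : Z (m + 1) →ₗ[Λ] P) (p : P →ₗ[Λ] Z m),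
      Module.Projective Λ P ∧ IsShortExact i p ∧ ∀ Q : FGModuleCat.{u} Λ,
        Module.Projective Λ Q → ∀ φ : Z (m + 1) →ₗ[Λ] Q, ∃ ψ : P →ₗ[Λ] Q, ψ ∘ₗ i = φ) (m : ℤ) :
    ExtVanish 0 (Z m) := by
  intro Q hQ k hk
  obtain ⟨k, rfl⟩ : ∃ l, k = l + 1 := ⟨k - 1, by omega⟩
  clear hk
  induction k generalizing m with
  | zero =>
    obtain ⟨P, i, p, hP, h, hext⟩ := hZ m
    exact ext_one_eq_zero_of_exists_extension h hP Q (hext Q hQ)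
  | succ k ih =>
    obtain ⟨P, i, p, hP, h, -⟩ := hZ m
    intro x
    obtain ⟨y, rfl⟩ := Ext.contravariant_sequence_exact₃ h.shortExact Q.obj x
      (ExtVanish.of_projective hP Q hQ (k + 1 + 1) (Nat.succ_pos _) _) (add_comm 1 (k + 1))
    rw [ih (m + 1) y, Ext.comp_zero]

/-- Gorenstein projective modules are the terms of two-sided chains of syzygies, all of which
have no extensions with projective modules. -/
theorem isGorensteinProjective_iff [IsNoetherianRing Λ] {M : FGModuleCat.{u} Λ} :
    IsGorensteinProjective M ↔ ∃ Z : ℤ → FGModuleCat.{u} Λ,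
      (∀ m, ExtVanish 0 (Z m)) ∧ (∀ m, IsKernelOfPresentation (Z (m + 1)) (Z m)) ∧
      ∃ m, Nonempty (M ≃ₗ[Λ] Z m) := by
  constructor
  · rintro ⟨P, d, hP, hd, hQ, e⟩
    let Z (m : ℤ) : FGModuleCat.{u} Λ := FGModuleCat.of Λ (LinearMap.ker (d m))
    let p (m : ℤ) : P (m + 1 + 1) →ₗ[Λ] Z m :=
      (d (m + 1)).codRestrict (LinearMap.ker (d m)) (hd m).apply_apply_eq_zero
    let i (m : ℤ) : Z m →ₗ[Λ] P (m + 1) := (LinearMap.ker (d m)).subtype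
    have hip : ∀ m x, i m (p m x) = d (m + 1) x := fun m x => rfl
    have hi : ∀ m, Function.Injective (i m) := fun m => Subtype.val_injective
    have hp : ∀ m, Function.Surjective (p m) := by
      rintro m ⟨x, hx⟩
      obtain ⟨y, rfl⟩ := (hd m x).1 hx
      exact ⟨y, rfl⟩
    have hs : ∀ m, IsShortExact (i (m + 1)) (p m) := by
      refine fun m => ⟨hi _, fun x => ⟨fun hx => ?_, ?_⟩, hp m⟩
      · have : d (m + 1) x = 0 := by rw [← hip, hx, map_zero]
        exact ⟨⟨x, this⟩, rfl⟩
      · rintro ⟨y, rfl⟩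
        exact Subtype.ext y.2
    refine ⟨Z, extVanish_of_chain Z fun m => ⟨_, _, _, hP _, hs m, fun Q hQ' φ => ?_⟩,
      fun m => ⟨_, _, _, hP _, hs m⟩, _, e⟩
    -- Composed with the epimorphism onto the cycles, `φ` becomes a cocycle of the complex of maps
    -- into `Q`. Acyclicity makes it a coboundary, which is the required extension.
    obtain ⟨ψ, hψ⟩ := (hQ Q hQ' (m + 1 + 1) (φ ∘ₗ p (m + 1))).1 (by
      ext x
      have : p (m + 1) (d (m + 1 + 1 + 1) x) = 0 := hi _ (by
        rw [hip, (hd _).apply_apply_eq_zero, map_zero])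
      simp [this])
    refine ⟨ψ, LinearMap.ext fun z => ?_⟩
    obtain ⟨x, rfl⟩ := hp (m + 1) z
    exact LinearMap.congr_fun hψ x
  · rintro ⟨Z, hE, hZ, m, ⟨e⟩⟩
    -- With differentials `i m ∘ p (m + 1)`, the kernel of `d (-1)` is the kernel of `p 0`, that is,
    -- the copy of `Z 1` in `P 0`.
    wlog hm : m = 1 generalizing Z m
    · refine this (fun k => Z (k + (m - 1))) (fun k => hE _) (fun k => ?_) 1
        (by rwa [add_sub_cancel]) rfl
      rw [add_right_comm]
      exact hZ _
    subst hm
    choose P i p hP hs using hZ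
    refine ⟨P, fun m => i m ∘ₗ p (m + 1), hP, fun m x => ⟨fun hx => ?_, ?_⟩,
      fun Q hQ m f => ⟨fun hf => ?_, ?_⟩, ⟨?_⟩⟩
    · have hx' : p (m + 1) x = 0 := (hs m).injective (by rw [map_zero]; exact hx)
      obtain ⟨z, rfl⟩ := ((hs (m + 1)).exact x).1 hx'
      obtain ⟨y, rfl⟩ := (hs (m + 1 + 1)).surjective z
      exact ⟨y, rfl⟩
    · rintro ⟨y, rfl⟩
      simp [(hs (m + 1)).exact.apply_apply_eq_zero]
    · obtain ⟨g, hg⟩ := (hs (m + 1)).exists_factorization f (LinearMap.ext fun z => by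
        obtain ⟨y, rfl⟩ := (hs (m + 1 + 1)).surjective z
        exact LinearMap.congr_fun hf y)
      obtain ⟨ψ, hψ⟩ := (hE m).exists_extension (hs m) hQ g
      refine ⟨ψ, LinearMap.ext fun x => ?_⟩
      rw [← hg, ← hψ]
      rfl
    · rintro ⟨g, rfl⟩
      ext x
      simp [(hs (m + 1)).exact.apply_apply_eq_zero]
    · refine e.trans ((LinearEquiv.ofInjective (i (0 : ℤ)) (hs 0).injective).trans
        (LinearEquiv.ofEq _ _ ?_))
      rw [LinearMap.ker_comp_of_ker_eq_bot _ (LinearMap.ker_eq_bot.2 (hs (-1)).injective)]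
      exact (hs 0).exact.linearMap_ker_eq.symm

theorem IsGorensteinProjective.of_equiv {M N : FGModuleCat.{u} Λ} (e : M ≃ₗ[Λ] N)
    (h : IsGorensteinProjective N) : IsGorensteinProjective M := by
  obtain ⟨P, d, hP, hd, hQ, ⟨e'⟩⟩ := h
  exact ⟨P, d, hP, hd, hQ, ⟨e.trans e'⟩⟩

theorem IsKernelOfPresentation.of_equiv {A A' C : FGModuleCat.{u} Λ}
    (h : IsKernelOfPresentation A C) (e : A' ≃ₗ[Λ] A) : IsKernelOfPresentation A' C := by
  obtain ⟨P, i, p, hP, h⟩ := h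
  refine ⟨P, i ∘ₗ e.toLinearMap, p, hP, h.injective.comp e.injective, fun x => ?_, h.surjective⟩
  rw [h.exact x, LinearMap.coe_comp, LinearEquiv.coe_coe, e.surjective.range_comp]

variable [IsNoetherianRing Λ]

theorem IsGorensteinProjective.extVanish {M : FGModuleCat.{u} Λ}
    (h : IsGorensteinProjective M) : ExtVanish 0 M := by
  obtain ⟨Z, hE, -, m, ⟨e⟩⟩ := isGorensteinProjective_iff.1 h
  exact (hE m).of_equiv e.symm

theorem IsGorensteinProjective.exists_cosyzygy {M : FGModuleCat.{u} Λ}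
    (h : IsGorensteinProjective M) :
    ∃ N, IsGorensteinProjective N ∧ IsKernelOfPresentation M N := by
  obtain ⟨Z, hE, hZ, m, ⟨e⟩⟩ := isGorensteinProjective_iff.1 h
  refine ⟨Z (m - 1), isGorensteinProjective_iff.2 ⟨Z, hE, hZ, _, ⟨LinearEquiv.refl _ _⟩⟩, ?_⟩
  have := hZ (m - 1)
  rw [sub_add_cancel] at this
  exact this.of_equiv e

/-- A class of modules without extensions with projective modules in which every module has a
cosyzygy consists of Gorenstein projective modules. -/
theorem isGorensteinProjective_of_coresolving (S : Set (FGModuleCat.{u} Λ))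
    (hE : ∀ A ∈ S, ExtVanish 0 A) (hS : ∀ A ∈ S, ∃ B ∈ S, IsKernelOfPresentation A B)
    {M : FGModuleCat.{u} Λ} (hM : M ∈ S) : IsGorensteinProjective M := by
  choose f hf using fun A : S => hS A A.2
  choose g hg using exists_isKernelOfPresentation (Λ := Λ)
  let F (A : S) : S := ⟨f A, (hf A).1⟩
  -- Arbitrary syzygies of `M` on the nonnegative side, cosyzygies chosen inside `S` on the negative
  -- side. Membership in `S` gives the vanishing on the negative side, and on the other it is
  -- inherited from `M`.
  let Z : ℤ → FGModuleCat.{u} Λ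
    | Int.ofNat n => g^[n] M
    | Int.negSucc n => (F^[n + 1] ⟨M, hM⟩ : S)
  have hneg : ∀ n, IsKernelOfPresentation (F^[n] ⟨M, hM⟩ : S).1 (F^[n + 1] ⟨M, hM⟩ : S).1 := by
    intro n
    rw [Function.iterate_succ_apply']
    exact (hf _).2
  have hpos : ∀ n, IsKernelOfPresentation (g^[n + 1] M) (g^[n] M) := by
    intro n
    rw [Function.iterate_succ_apply']
    exact hg _
  refine isGorensteinProjective_iff.2 ⟨Z, ?_, ?_, 0, ⟨LinearEquiv.refl _ _⟩⟩
  · rintro (n | n)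
    · change ExtVanish 0 (g^[n] M)
      induction n with
      | zero => exact hE _ hM
      | succ n ih => exact (hpos n).extVanish ih
    · exact hE _ (F^[n + 1] ⟨M, hM⟩ : S).2
  -- Degree `-1` is separate because the two halves of the chain meet there, at `M`.
  · rintro (n | _ | n)
    · exact hpos n
    · exact hneg 0
    · exact hneg (n + 1)

theorem isGorensteinProjective_of_projective {M : FGModuleCat.{u} Λ}
    (h : Module.Projective Λ M) : IsGorensteinProjective M := by
  refine isGorensteinProjective_of_coresolving {A | Module.Projective Λ A}
    (fun A hA => .of_projective hA) (fun A hA => ⟨FGModuleCat.of Λ PUnit.{u + 1},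
      projective_punit, A, LinearMap.id, 0, hA, Function.injective_id,
      fun x => ⟨fun _ => ⟨x, rfl⟩, fun _ => rfl⟩, fun _ => ⟨0, rfl⟩⟩) h

/-- Kernels of epimorphisms from projective to Gorenstein projective modules are Gorenstein
projective. -/
theorem IsKernelOfPresentation.isGorensteinProjective {A C : FGModuleCat.{u} Λ}
    (h : IsKernelOfPresentation A C) (hC : IsGorensteinProjective C) :
    IsGorensteinProjective A := by
  refine isGorensteinProjective_of_coresolving (insert A {B | IsGorensteinProjective B}) ?_ ?_
    (Set.mem_insert _ _)
  · rintro _ (rfl | hB)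
    exacts [h.extVanish hC.extVanish, hB.extVanish]
  · rintro _ (rfl | hB)
    · exact ⟨C, .inr hC, h⟩
    · obtain ⟨N, hN, hBN⟩ := hB.exists_cosyzygy
      exact ⟨N, .inr hN, hBN⟩

/-- The class of all such extensions is coresolving, by the horseshoe construction: `B` embeds in
the sum of the projectives receiving `A` and `C`, and the cokernel is again an extension of the two
cosyzygies. -/
theorem IsGorensteinProjective.of_extension {A B C : FGModuleCat.{u} Λ} {i : A →ₗ[Λ] B}
    {p : B →ₗ[Λ] C} (h : IsShortExact i p) (hA : IsGorensteinProjective A)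
    (hC : IsGorensteinProjective C) : IsGorensteinProjective B := by
  refine isGorensteinProjective_of_coresolving
    {B | ∃ (A C : FGModuleCat.{u} Λ) (i : A →ₗ[Λ] B) (p : B →ₗ[Λ] C), IsShortExact i p ∧
      IsGorensteinProjective A ∧ IsGorensteinProjective C} ?_ ?_ ⟨A, C, i, p, h, hA, hC⟩
  · rintro B ⟨A, C, i, p, h, hA, hC⟩
    exact .mid h hA.extVanish hC.extVanish
  · rintro B ⟨A, C, i, p, h, hA, hC⟩
    obtain ⟨A', hA', P, a, a', hP, ha⟩ := hA.exists_cosyzygy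
    obtain ⟨C', hC', Q, c, c', hQ, hc⟩ := hC.exists_cosyzygy
    -- Extending `a` over `B` uses `Ext¹(C, P) = 0`. It provides the first coordinate of the
    -- embedding `j`.
    obtain ⟨b, hb⟩ := hC.extVanish.exists_extension h hP a
    have hb' : ∀ x, b (i x) = a x := fun x => LinearMap.congr_fun hb x
    let j : B →ₗ[Λ] FGModuleCat.of Λ (P × Q) := b.prod (c ∘ₗ p)
    have hj : Function.Injective j := by
      refine (injective_iff_map_eq_zero j).2 fun x hx => ?_
      have h1 : b x = 0 := congrArg Prod.fst hx
      have h2 : c (p x) = 0 := congrArg Prod.snd hx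
      obtain ⟨y, rfl⟩ := (h.exact x).1 (hc.injective (by rw [h2, map_zero]))
      rw [hb'] at h1
      rw [ha.injective (h1.trans (map_zero a).symm), map_zero]
    have hB := isShortExact_coker hj
    obtain ⟨q, hq⟩ := hB.exists_factorization (c' ∘ₗ LinearMap.snd Λ P Q)
      (LinearMap.ext fun x => hc.exact.apply_apply_eq_zero (p x))
    obtain ⟨k, hk⟩ := ha.exists_factorization
      ((LinearMap.range j).mkQ ∘ₗ LinearMap.inl Λ P Q) (LinearMap.ext fun x => by
        refine (Submodule.Quotient.mk_eq_zero _).2 ⟨i x, ?_⟩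
        exact Prod.ext (hb' x)
          (by change c (p (i x)) = 0; rw [h.exact.apply_apply_eq_zero, map_zero]))
    have hq' : ∀ x y, q ((LinearMap.range j).mkQ (x, y)) = c' y :=
      fun x y => LinearMap.congr_fun hq (x, y)
    have hk' : ∀ x, k (a' x) = (LinearMap.range j).mkQ (x, 0) := fun x => LinearMap.congr_fun hk x
    refine ⟨FGModuleCat.of Λ ((P × Q) ⧸ LinearMap.range j), ⟨A', C', k, q, ⟨?_, ?_, ?_⟩, hA', hC'⟩,
      FGModuleCat.of Λ (P × Q), j, _, inferInstanceAs (Module.Projective Λ (P × Q)), hB⟩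
    · refine (injective_iff_map_eq_zero k).2 fun x hx => ?_
      obtain ⟨x, rfl⟩ := ha.surjective x
      rw [hk'] at hx
      obtain ⟨y, hy⟩ := (Submodule.Quotient.mk_eq_zero _).1 hx
      have h1 : b y = x := congrArg Prod.fst hy
      have h2 : c (p y) = 0 := congrArg Prod.snd hy
      obtain ⟨z, rfl⟩ := (h.exact y).1 (hc.injective (by rw [h2, map_zero]))
      rw [← h1, hb', ha.exact.apply_apply_eq_zero]
    · intro z
      constructor
      · obtain ⟨⟨x, y⟩, rfl⟩ := Submodule.mkQ_surjective _ z
        intro hz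
        rw [hq'] at hz
        obtain ⟨w, rfl⟩ := (hc.exact y).1 hz
        obtain ⟨w, rfl⟩ := h.surjective w
        refine ⟨a' (x - b w), ?_⟩
        rw [hk']
        refine (Submodule.Quotient.eq _).2 ⟨-w, ?_⟩
        refine Prod.ext ?_ ?_
        · change b (-w) = x - b w - x
          simp
        · change c (p (-w)) = 0 - c (p w)
          simp
      · rintro ⟨x, rfl⟩
        obtain ⟨x, rfl⟩ := ha.surjective x
        rw [hk', hq', map_zero]
    · intro z
      obtain ⟨y, rfl⟩ := hc.surjective z
      exact ⟨(LinearMap.range j).mkQ (0, y), hq' 0 y⟩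

end GorensteinProjective

/-! ### Gorenstein projective dimension and its comparison with projective dimension. -/

theorem iInf_natCast_le_iff {p : ℕ → Prop} {n : ℕ} :
    (⨅ (k : ℕ) (_ : p k), (k : ℕ∞)) ≤ n ↔ ∃ k ≤ n, p k := by
  constructor
  · intro h
    by_contra! hp
    have : ((n + 1 : ℕ) : ℕ∞) ≤ ⨅ (k : ℕ) (_ : p k), (k : ℕ∞) :=
      le_iInf₂ fun k hk => Nat.cast_le.2 (by by_contra hlt; exact hp k (by omega) hk)
    exact absurd (Nat.cast_le.1 (this.trans h)) (by omega)
  · rintro ⟨k, hk, h⟩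
    exact (iInf₂_le k h).trans (Nat.cast_le.2 hk)

section Dimensions

variable {Λ : Type u} [Ring Λ]

theorem pd_le_iff {M : FGModuleCat.{u} Λ} {n : ℕ} :
    pd M ≤ n ↔ HasProjectiveDimensionLE M.obj n :=
  iInf_natCast_le_iff.trans
    ⟨fun ⟨_, hk, h⟩ => hasProjectiveDimensionLE_mono hk h, fun h => ⟨n, le_rfl, h⟩⟩

theorem Gpd_le_iff {M : FGModuleCat.{u} Λ} {n : ℕ} :
    Gpd M ≤ n ↔ ∃ k ≤ n, HasResolution (Gproj Λ) k M :=
  iInf_natCast_le_iff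

/-- The pushout of a short exact sequence along a monomorphism. -/
theorem IsShortExact.exists_pushout {A B C A' D : FGModuleCat.{u} Λ} {i : A →ₗ[Λ] B}
    {p : B →ₗ[Λ] C} (h : IsShortExact i p) {j : A →ₗ[Λ] A'} {q : A' →ₗ[Λ] D}
    (h' : IsShortExact j q) : ∃ (E : FGModuleCat.{u} Λ) (i' : A' →ₗ[Λ] E) (p' : E →ₗ[Λ] C)
      (j' : B →ₗ[Λ] E) (q' : E →ₗ[Λ] D), IsShortExact i' p' ∧ IsShortExact j' q' := by
  -- The pushout is the cokernel of this map, whose sign identifies `i a` with `j a`.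
  let f : A →ₗ[Λ] FGModuleCat.of Λ (B × A') := i.prod (-j)
  have hf := isShortExact_coker (i := f) (fun x y hxy => h.injective (congrArg Prod.fst hxy))
  set π := (LinearMap.range f).mkQ
  obtain ⟨p', hp'⟩ := hf.exists_factorization (p ∘ₗ LinearMap.fst Λ B A')
    (LinearMap.ext fun x => h.exact.apply_apply_eq_zero x)
  obtain ⟨q', hq'⟩ := hf.exists_factorization (q ∘ₗ LinearMap.snd Λ B A')
    (LinearMap.ext fun x => by
      change q (-j x) = 0
      rw [map_neg, h'.exact.apply_apply_eq_zero, neg_zero])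
  have hp : ∀ x y, p' (π (x, y)) = p x := fun x y => LinearMap.congr_fun hp' (x, y)
  have hq : ∀ x y, q' (π (x, y)) = q y := fun x y => LinearMap.congr_fun hq' (x, y)
  have hzero : ∀ z, π z = 0 → ∃ a, i a = z.1 ∧ -j a = z.2 := fun z hz => by
    obtain ⟨a, ha⟩ := (Submodule.Quotient.mk_eq_zero _).1 hz
    exact ⟨a, congrArg Prod.fst ha, congrArg Prod.snd ha⟩
  have hglue : ∀ a, π (i a, 0) = π (0, j a) := fun a =>
    (Submodule.Quotient.eq _).2 ⟨a, Prod.ext (sub_zero _).symm (zero_sub _).symm⟩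
  have hadd : ∀ x y, π (x, y) = π (x, 0) + π (0, y) := fun x y => by
    rw [← map_add, Prod.mk_add_mk, add_zero, zero_add]
  have hsurj : Function.Surjective π := Submodule.mkQ_surjective _
  refine ⟨FGModuleCat.of Λ ((B × A') ⧸ LinearMap.range f), π ∘ₗ LinearMap.inr Λ B A', p',
    π ∘ₗ LinearMap.inl Λ B A', q', ⟨?_, ?_, ?_⟩, ⟨?_, ?_, ?_⟩⟩
  · refine (injective_iff_map_eq_zero _).2 fun y hy => ?_
    obtain ⟨a, ha, hy⟩ := hzero (0, y) hy
    have : a = 0 := h.injective (ha.trans (map_zero i).symm)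
    exact hy.symm.trans (by rw [this, map_zero, neg_zero])
  · intro z
    constructor
    · obtain ⟨⟨x, y⟩, rfl⟩ := hsurj z
      intro hz
      rw [hp] at hz
      obtain ⟨a, rfl⟩ := (h.exact x).1 hz
      refine ⟨j a + y, ?_⟩
      rw [hadd, hglue, ← map_add, Prod.mk_add_mk, zero_add]
      rfl
    · rintro ⟨y, rfl⟩
      exact (hp 0 y).trans (map_zero p)
  · intro c
    obtain ⟨b, rfl⟩ := h.surjective c
    exact ⟨_, hp b 0⟩
  · refine (injective_iff_map_eq_zero _).2 fun x hx => ?_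
    obtain ⟨a, hx, ha⟩ := hzero (x, 0) hx
    have : a = 0 := h'.injective ((neg_eq_zero.1 ha).trans (map_zero j).symm)
    exact hx.symm.trans (by rw [this, map_zero])
  · intro z
    constructor
    · obtain ⟨⟨x, y⟩, rfl⟩ := hsurj z
      intro hz
      rw [hq] at hz
      obtain ⟨a, rfl⟩ := (h'.exact y).1 hz
      refine ⟨x + i a, ?_⟩
      rw [hadd, ← hglue, ← map_add, Prod.mk_add_mk, zero_add]
      rfl
    · rintro ⟨x, rfl⟩
      exact (hq x 0).trans (map_zero q)
  · intro d
    obtain ⟨y, rfl⟩ := h'.surjective d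
    exact ⟨_, hq 0 y⟩

variable [IsNoetherianRing Λ]

theorem extVanish_of_hasResolution {n : ℕ} {M : FGModuleCat.{u} Λ}
    (h : HasResolution (Gproj Λ) n M) : ExtVanish n M := by
  induction n generalizing M with
  | zero =>
    obtain ⟨G, hG, ⟨e⟩⟩ := h
    exact (IsGorensteinProjective.extVanish hG).of_equiv e
  | succ n ih =>
    obtain ⟨G, hG, N, i, p, hi, hip, hp, hN⟩ := h
    exact .right ⟨hi, hip, hp⟩ (ih hN)
      ((IsGorensteinProjective.extVanish hG).mono (Nat.zero_le _))

theorem extVanish_of_Gpd_le {n : ℕ} {M : FGModuleCat.{u} Λ} (h : Gpd M ≤ n) : ExtVanish n M := by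
  obtain ⟨k, hk, hM⟩ := Gpd_le_iff.1 h
  exact (extVanish_of_hasResolution hM).mono hk

/-- A module with a Gorenstein projective resolution of length `n` embeds in a module of projective
dimension at most `n` with Gorenstein projective cokernel. -/
theorem HasResolution.exists_embedding {n : ℕ} {M : FGModuleCat.{u} Λ}
    (h : HasResolution (Gproj Λ) n M) : ∃ (H G : FGModuleCat.{u} Λ) (i : M →ₗ[Λ] H)
      (p : H →ₗ[Λ] G), IsShortExact i p ∧ HasProjectiveDimensionLE H.obj n ∧
      IsGorensteinProjective G := by
  induction n generalizing M with
  | zero =>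
    obtain ⟨G, hG, ⟨e⟩⟩ := h
    obtain ⟨N, hN, P, i, p, hP, hs⟩ := (IsGorensteinProjective.of_equiv e.symm hG).exists_cosyzygy
    exact ⟨P, N, i, p, hs, hasProjectiveDimensionLE_zero_iff.2 hP, hN⟩
  | succ n ih =>
    obtain ⟨G, hG, N, i, p, hi, hip, hp, hN⟩ := h
    obtain ⟨N', D, j, q, hjq, hN', hD⟩ := ih hN
    -- The pushout `E` is an extension of `D` by `G`, hence Gorenstein projective, and it embeds in
    -- a projective `P` with cokernel `D'`. Take `H = P / N'`: it contains `M = E / N'` with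
    -- quotient `D'`, and its dimension is at most one more than the bound for `N'`.
    obtain ⟨E, i', p', j', q', hE, hE'⟩ :=
      (⟨hi, hip, hp⟩ : IsShortExact i p).exists_pushout hjq
    obtain ⟨D', hD', P, k, r, hP, hk⟩ :=
      (IsGorensteinProjective.of_extension hE' hG hD).exists_cosyzygy
    have hki : Function.Injective (k ∘ₗ i') := hk.injective.comp hE.injective
    have hH := isShortExact_coker hki
    obtain ⟨f, hf⟩ := hE.exists_factorization ((LinearMap.range (k ∘ₗ i')).mkQ ∘ₗ k)
      (LinearMap.ext fun x => hH.exact.apply_apply_eq_zero x)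
    obtain ⟨g, hg⟩ := hH.exists_factorization r
      (LinearMap.ext fun x => hk.exact.apply_apply_eq_zero (i' x))
    have hf' : ∀ x, f (p' x) = (LinearMap.range (k ∘ₗ i')).mkQ (k x) :=
      fun x => LinearMap.congr_fun hf x
    have hg' : ∀ x, g ((LinearMap.range (k ∘ₗ i')).mkQ x) = r x := fun x => LinearMap.congr_fun hg x
    refine ⟨_, D', f, g, ⟨?_, ?_, ?_⟩, (hasProjectiveDimensionLE_succ_iff hH hP n).2 hN', hD'⟩
    · refine (injective_iff_map_eq_zero f).2 fun m hm => ?_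
      obtain ⟨x, rfl⟩ := hE.surjective m
      rw [hf'] at hm
      obtain ⟨y, hy⟩ := (hH.exact _).1 hm
      rw [← hk.injective hy, hE.exact.apply_apply_eq_zero]
    · intro z
      obtain ⟨x, rfl⟩ := hH.surjective z
      rw [hg']
      constructor
      · intro hx
        obtain ⟨e, rfl⟩ := (hk.exact x).1 hx
        exact ⟨p' e, hf' e⟩
      · rintro ⟨m, hm⟩
        obtain ⟨e, rfl⟩ := hE.surjective m
        rw [← hg', ← hm, hf', hg', hk.exact.apply_apply_eq_zero]
    · intro d
      obtain ⟨x, rfl⟩ := hk.surjective d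
      exact ⟨_, hg' x⟩

/-- For a projective `P` mapping onto `H`, the preimage of `M` in `P` is the kernel of `P → G`,
hence Gorenstein projective. It maps onto `M` with the same kernel as `P → H`, whose projective
dimension is one lower. -/
theorem hasResolution_of_embedding {n : ℕ} {M H G : FGModuleCat.{u} Λ} {i : M →ₗ[Λ] H}
    {p : H →ₗ[Λ] G} (h : IsShortExact i p) (hH : HasProjectiveDimensionLE H.obj n)
    (hG : IsGorensteinProjective G) : HasResolution (Gproj Λ) n M := by
  induction n generalizing M H G with
  | zero =>
    exact ⟨M, IsKernelOfPresentation.isGorensteinProjective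
      ⟨H, i, p, hasProjectiveDimensionLE_zero_iff.1 hH, h⟩ hG, ⟨LinearEquiv.refl _ _⟩⟩
  | succ n ih =>
    obtain ⟨N, P, j, q, hP, hs⟩ := exists_isKernelOfPresentation H
    have hN : HasResolution (Gproj Λ) n N :=
      ih (G := FGModuleCat.of Λ PUnit.{u + 1}) (i := LinearMap.id) (p := 0)
        ⟨Function.injective_id, fun x => ⟨fun _ => ⟨x, rfl⟩, fun _ => rfl⟩, fun _ => ⟨0, rfl⟩⟩
        ((hasProjectiveDimensionLE_succ_iff hs hP n).1 hH)
        (isGorensteinProjective_of_projective projective_punit)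
    have hpq := isShortExact_ker (p := p ∘ₗ q) (h.surjective.comp hs.surjective)
    let e := LinearEquiv.ofInjective i h.injective
    let ρ : LinearMap.ker (p ∘ₗ q) →ₗ[Λ] M := e.symm.toLinearMap ∘ₗ
      (q ∘ₗ (LinearMap.ker (p ∘ₗ q)).subtype).codRestrict (LinearMap.range i)
        fun x => (h.exact _).1 x.2
    have hρ : ∀ x, i (ρ x) = q x.1 := fun x => congrArg Subtype.val (e.apply_symm_apply _)
    refine ⟨FGModuleCat.of Λ (LinearMap.ker (p ∘ₗ q)),
      IsKernelOfPresentation.isGorensteinProjective ⟨P, _, _, hP, hpq⟩ hG, N,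
      j.codRestrict (LinearMap.ker (p ∘ₗ q)) fun x => by simp [hs.exact.apply_apply_eq_zero], ρ,
      fun x y hxy => hs.injective (congrArg Subtype.val hxy), fun x => ⟨fun hx => ?_, ?_⟩,
      fun m => ?_, hN⟩
    · obtain ⟨y, hy⟩ := (hs.exact x.1).1 (by rw [← hρ, hx, map_zero])
      exact ⟨y, Subtype.ext hy⟩
    · rintro ⟨y, rfl⟩
      refine h.injective ?_
      exact (hρ _).trans ((hs.exact.apply_apply_eq_zero y).trans (map_zero i).symm)
    · obtain ⟨x, hx⟩ := hs.surjective (i m)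
      refine ⟨⟨x, ?_⟩, h.injective ((hρ _).trans hx)⟩
      change p (q x) = 0
      rw [hx, h.exact.apply_apply_eq_zero]

theorem hasResolution_of_hasProjectiveDimensionLE {n : ℕ} {M : FGModuleCat.{u} Λ}
    (h : HasProjectiveDimensionLE M.obj n) : HasResolution (Gproj Λ) n M :=
  hasResolution_of_embedding (G := FGModuleCat.of Λ PUnit.{u + 1}) (i := LinearMap.id) (p := 0)
    ⟨Function.injective_id, fun x => ⟨fun _ => ⟨x, rfl⟩, fun _ => rfl⟩, fun _ => ⟨0, rfl⟩⟩ h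
    (isGorensteinProjective_of_projective projective_punit)

/-- If `Gpd M` is finite, then it is detected by `Ext` into projective modules. -/
theorem Gpd_le_of_extVanish {n : ℕ} {M : FGModuleCat.{u} Λ} (hM : Gpd M < ⊤)
    (h : ExtVanish n M) : Gpd M ≤ n := by
  obtain ⟨k, hk⟩ := ENat.ne_top_iff_exists.1 hM.ne
  obtain ⟨l, -, hl⟩ := Gpd_le_iff.1 hk.ge
  obtain ⟨H, G, i, p, hs, hH, hG⟩ := hl.exists_embedding
  exact Gpd_le_iff.2 ⟨n, le_rfl, hasResolution_of_embedding hs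
    (hasProjectiveDimensionLE_of_extVanish hH (.mid hs h (hG.extVanish.mono (Nat.zero_le n)))) hG⟩

theorem Gpd_le_pd (M : FGModuleCat.{u} Λ) : Gpd M ≤ pd M := by
  exact le_iInf₂ fun n hn =>
    Gpd_le_iff.2 ⟨n, le_rfl, hasResolution_of_hasProjectiveDimensionLE hn⟩

theorem pd_eq_Gpd {M : FGModuleCat.{u} Λ} (hM : pd M < ⊤) : pd M = Gpd M := by
  refine le_antisymm ?_ (Gpd_le_pd M)
  obtain ⟨k, hk⟩ := ENat.ne_top_iff_exists.1 hM.ne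
  obtain ⟨n, hn⟩ := ENat.ne_top_iff_exists.1 ((Gpd_le_pd M).trans_lt hM).ne
  rw [← hn]
  exact pd_le_iff.2 (hasProjectiveDimensionLE_of_extVanish (pd_le_iff.1 hk.ge)
    (extVanish_of_Gpd_le hn.ge))

/-- Every finite Gorenstein projective dimension is a finite projective dimension. -/
theorem exists_pd_eq_Gpd {M : FGModuleCat.{u} Λ} (hM : Gpd M < ⊤) :
    ∃ H : FGModuleCat.{u} Λ, pd H = Gpd M := by
  obtain ⟨n, hn⟩ := ENat.ne_top_iff_exists.1 hM.ne
  obtain ⟨l, hln, hl⟩ := Gpd_le_iff.1 hn.ge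
  obtain ⟨H, G, i, p, hs, hH, hG⟩ := hl.exists_embedding
  -- Any bound on `pd H` yields a resolution of `M` of that length through the same embedding, so
  -- `pd H` cannot drop below `Gpd M`.
  refine ⟨H, le_antisymm ?_ (le_iInf₂ fun k hk => Gpd_le_iff.2
    ⟨k, le_rfl, hasResolution_of_embedding hs hk hG⟩)⟩
  rw [← hn]
  exact pd_le_iff.2 (hasProjectiveDimensionLE_mono hln hH)

variable (Λ) in
theorem finGpdim_eq_finDim : finGpdim Λ = finDim Λ := by
  refine le_antisymm (iSup₂_le fun M hM => ?_) (iSup₂_le fun M _ => iSup_le fun hM => ?_)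
  · obtain ⟨H, hH⟩ := exists_pd_eq_Gpd hM
    rw [← hH]
    exact le_iSup₂_of_le H (Set.mem_univ H) (le_iSup_of_le (hH.trans_lt hM) le_rfl)
  · rw [pd_eq_Gpd hM]
    exact le_iSup₂_of_le M ((Gpd_le_pd M).trans_lt hM) le_rfl

theorem glGpdim_le_injDim (h : glGpdim Λ < ⊤) : glGpdim Λ ≤ injDim (FGModuleCat.of Λ Λ) := by
  refine iSup₂_le fun M _ => le_iInf₂ fun n hn => Gpd_le_of_extVanish ?_
    (.of_hasInjectiveDimensionLE hn M)
  exact (le_iSup₂_of_le (f := fun (M : FGModuleCat.{u} Λ) (_ : M ∈ Set.univ) => Gpd M) M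
    (Set.mem_univ M) le_rfl).trans_lt h

end Dimensions

/-! ### Classes modulo projectives and iterated syzygies. -/

section Classes

variable {Λ : Type u} [Ring Λ]

/-- The class of `M` in `K / ⟨𝒫⟩`. -/
def clsBar (M : FGModuleCat.{u} Λ) : KProj Λ :=
  QuotientAddGroup.mk' (gen (projClass Λ)) (cls M)

theorem clsBar_prod {M X Y : FGModuleCat.{u} Λ} (e : M ≃ₗ[Λ] (X × Y)) :
    clsBar M = clsBar X + clsBar Y := by
  rw [clsBar, cls_prod e, map_add]
  rfl

theorem clsBar_of_prod (X Y : FGModuleCat.{u} Λ) :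
    clsBar (FGModuleCat.of Λ (X × Y)) = clsBar X + clsBar Y :=
  clsBar_prod (LinearEquiv.refl Λ (X × Y))

theorem clsBar_eq_of_equiv {M N : FGModuleCat.{u} Λ} (e : M ≃ₗ[Λ] N) : clsBar M = clsBar N := by
  rw [clsBar, cls_eq_of_equiv e]
  rfl

theorem IsSummand.trans {X Y Z : FGModuleCat.{u} Λ} (h : IsSummand X Y) (h' : IsSummand Y Z) :
    IsSummand X Z := by
  obtain ⟨X', ⟨e⟩⟩ := h
  obtain ⟨Y', ⟨e'⟩⟩ := h'
  exact ⟨FGModuleCat.of Λ (X' × Y'),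
    ⟨(e'.trans (e.prodCongr (LinearEquiv.refl Λ Y'))).trans (LinearEquiv.prodAssoc Λ X X' Y')⟩⟩

theorem IsSummand.projective {X Y : FGModuleCat.{u} Λ} (h : IsSummand X Y)
    (hY : Module.Projective Λ Y) : Module.Projective Λ X :=
  hasProjectiveDimensionLE_zero_iff.1
    (h.hasProjectiveDimensionLE (hasProjectiveDimensionLE_zero_iff.2 hY))

theorem mem_addClosure_self (M : FGModuleCat.{u} Λ) : M ∈ addClosure M :=
  ⟨1, FGModuleCat.of Λ PUnit.{u + 1}, ⟨(LinearEquiv.funUnique (Fin 1) Λ M).trans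
    (LinearEquiv.prodUnique (R := Λ) (M := M) (M₂ := PUnit.{u + 1})).symm⟩⟩

theorem hasProjectiveDimensionLE_of_mem_addClosure {M X : FGModuleCat.{u} Λ} {n : ℕ}
    (hM : HasProjectiveDimensionLE M.obj n) (hX : X ∈ addClosure M) :
    HasProjectiveDimensionLE X.obj n := by
  obtain ⟨s, hs⟩ := hX
  refine hs.hasProjectiveDimensionLE ?_
  clear hs
  induction s with
  | zero =>
    have : Limits.IsZero (FGModuleCat.of Λ (Fin 0 → M)).obj :=
      @ModuleCat.isZero_of_subsingleton _ _ _ (inferInstanceAs (Subsingleton (Fin 0 → M)))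
    have := this.hasProjectiveDimensionLT_zero
    exact hasProjectiveDimensionLT_of_ge _ 0 (n + 1) (Nat.zero_le _)
  | succ s ih =>
    exact (isShortExact_fin_succ M s).shortExact.hasProjectiveDimensionLT_X₂ (n + 1) hM ih

/-- A homomorphism out of `K / ⟨𝒫⟩` is given by a function on modules that is additive on direct
sums and vanishes on projective modules. -/
theorem exists_hom_clsBar {A : Type*} [AddCommGroup A] (f : FGModuleCat.{u} Λ → A)
    (hf : ∀ M X Y : FGModuleCat.{u} Λ, (M ≃ₗ[Λ] (X × Y)) → f M = f X + f Y)
    (hf' : ∀ P : FGModuleCat.{u} Λ, Module.Projective Λ P → f P = 0) :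
    ∃ F : KProj Λ →+ A, ∀ M, F (clsBar M) = f M := by
  let F₀ : KGroup Λ →+ A := QuotientAddGroup.lift (splitRelations Λ) (FreeAbelianGroup.lift f) (by
    rw [splitRelations, AddSubgroup.closure_le]
    rintro _ ⟨M, X, Y, ⟨e⟩, rfl⟩
    change FreeAbelianGroup.lift f _ = 0
    simp [hf M X Y e])
  have hF₀ : ∀ M, F₀ (cls M) = f M := fun M => FreeAbelianGroup.lift_apply_of f M
  refine ⟨QuotientAddGroup.lift (gen (projClass Λ)) F₀ ?_, fun M => hF₀ M⟩
  rw [gen, AddSubgroup.closure_le]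
  rintro _ ⟨M, -, hM, rfl⟩
  exact (hF₀ M).trans (hf' M (hM.elim id id))

variable [IsArtinianRing Λ]

/-- In a class of modules that is closed under direct summands, all classes are generated by those
of the indecomposable modules. -/
theorem cls_mem_gen {S : Set (FGModuleCat.{u} Λ)} (hS : ∀ X ∈ S, ∀ Z, IsSummand Z X → Z ∈ S)
    {M : FGModuleCat.{u} Λ} (hM : M ∈ S) : cls M ∈ gen S := by
  induction h : (Module.length Λ M).toNat using Nat.strong_induction_on generalizing M with
  | h n ih =>
    by_cases h0 : Subsingleton M
    · rw [cls_eq_zero M]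
      exact zero_mem _
    by_cases hi : IsIndecomposable M
    · exact AddSubgroup.subset_closure ⟨M, hi, .inl hM, rfl⟩
    rw [IsIndecomposable, not_and] at hi
    push Not at hi
    obtain ⟨X, Y, ⟨e⟩, hX, hY⟩ := hi (not_subsingleton_iff_nontrivial.1 h0)
    have hlen : (Module.length Λ M).toNat =
        (Module.length Λ X).toNat + (Module.length Λ Y).toNat := by
      rw [e.length_eq, Module.length_prod,
        ENat.toNat_add Module.length_ne_top Module.length_ne_top]
    have hpos : ∀ Z : FGModuleCat.{u} Λ, Nontrivial Z → 0 < (Module.length Λ Z).toNat :=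
      fun Z _ => Nat.pos_of_ne_zero fun h => (ENat.toNat_eq_zero.1 h).elim
        Module.length_pos.ne' Module.length_ne_top
    have hX' := hpos X hX
    have hY' := hpos Y hY
    rw [cls_prod e]
    exact add_mem (ih _ (by omega) (hS M hM X ⟨Y, ⟨e⟩⟩) rfl)
      (ih _ (by omega) (hS M hM Y ⟨X, ⟨e.trans (LinearEquiv.prodComm Λ X Y)⟩⟩) rfl)

theorem clsBar_eq_zero_of_projective {P : FGModuleCat.{u} Λ} (hP : Module.Projective Λ P) :
    clsBar P = 0 :=
  (QuotientAddGroup.eq_zero_iff _).2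
    (cls_mem_gen (S := projClass Λ) (fun _ hX _ hZ => hZ.projective hX) hP)

theorem clsBar_mem_genBar (M : FGModuleCat.{u} Λ) : clsBar M ∈ genBar M :=
  ⟨cls M, cls_mem_gen (S := addClosure M) (fun _ hX _ hZ => hX.imp fun _ h => hZ.trans h)
    (mem_addClosure_self M), rfl⟩

theorem isShortExact_syzygy (M : FGModuleCat.{u} Λ) :
    IsShortExact (A := syzygy M) (LinearMap.ker (coverMap M)).subtype (coverMap M) :=
  isShortExact_ker (coverMap_isProjectiveCover M).surjective

/-- The length of the syzygy is additive on direct sums and vanishes on projectives, so it factors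
through `K / ⟨𝒫⟩`. When it is zero, the projective cover is an isomorphism. No uniqueness of
decompositions is needed. -/
theorem projective_of_clsBar_eq_zero {M : FGModuleCat.{u} Λ} (h : clsBar M = 0) :
    Module.Projective Λ M := by
  obtain ⟨F, hF⟩ := exists_hom_clsBar (Λ := Λ)
    (fun M => ((Module.length Λ (syzygy M)).toNat : ℤ)) (fun M X Y e => by
      obtain ⟨e⟩ := syzygy_prod e
      rw [e.length_eq, Module.length_prod,
        ENat.toNat_add Module.length_ne_top Module.length_ne_top, Nat.cast_add])
    (fun P hP => by
      have := syzygy_subsingleton P hP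
      rw [Module.length_eq_zero, ENat.toNat_zero, Nat.cast_zero])
  have h0 : Module.length Λ (syzygy M) = 0 := by
    have h1 := hF M
    rw [h, map_zero, eq_comm, Nat.cast_eq_zero, ENat.toNat_eq_zero] at h1
    exact h1.resolve_right Module.length_ne_top
  have hs : Subsingleton (LinearMap.ker (coverMap M)) :=
    (Module.length_eq_zero_iff (R := Λ) (M := syzygy M)).1 h0
  have := (coverMap_isProjectiveCover M).projective
  exact Module.Projective.of_equiv (LinearEquiv.ofBijective (coverMap M)
    ⟨LinearMap.ker_eq_bot.1 (Submodule.subsingleton_iff_eq_bot.1 hs),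
      (coverMap_isProjectiveCover M).surjective⟩)

theorem syzygyHomBar_clsBar (M : FGModuleCat.{u} Λ) :
    syzygyHomBar Λ (clsBar M) = clsBar (syzygy M) :=
  congrArg (QuotientAddGroup.mk' (gen (projClass Λ))) (syzygyHom_cls M)

theorem iterate_syzygyHomBar_clsBar (m : ℕ) (M : FGModuleCat.{u} Λ) :
    (syzygyHomBar Λ)^[m] (clsBar M) = clsBar (syzygy^[m] M) := by
  induction m with
  | zero => rfl
  | succ m ih => rw [Function.iterate_succ_apply', ih, syzygyHomBar_clsBar,
      Function.iterate_succ_apply']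

/-- An inclusion suffices: it reduces additive statements about the image to classes of `m`-th
syzygies. The projective alternative is there because `gen` also contains the projective
indecomposables. -/
theorem iterate_syzygyHomBar_image_genBar_subset (m : ℕ) (M : FGModuleCat.{u} Λ) :
    (syzygyHomBar Λ)^[m] '' genBar M ⊆ AddSubgroup.closure {z | ∃ X : FGModuleCat.{u} Λ,
      (X ∈ addClosure M ∨ Module.Projective Λ X) ∧ z = clsBar (syzygy^[m] X)} := by
  rintro _ ⟨_, ⟨x, hx, rfl⟩, rfl⟩
  induction hx using AddSubgroup.closure_induction with
  | mem x hx =>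
    obtain ⟨X, -, hX, rfl⟩ := hx
    exact AddSubgroup.subset_closure ⟨X, hX, iterate_syzygyHomBar_clsBar m X⟩
  | zero =>
    rw [map_zero, iterate_map_zero]
    exact zero_mem _
  | add x y _ _ hx hy =>
    rw [map_add, iterate_map_add]
    exact add_mem hx hy
  | neg x _ hx =>
    rw [map_neg, iterate_map_neg]
    exact neg_mem hx

theorem hasProjectiveDimensionLE_iff_iterate_syzygy {n : ℕ} {M : FGModuleCat.{u} Λ} :
    HasProjectiveDimensionLE M.obj n ↔ Module.Projective Λ (syzygy^[n] M) := by
  induction n generalizing M with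
  | zero => exact hasProjectiveDimensionLE_zero_iff
  | succ n ih =>
    rw [Function.iterate_succ_apply, ← ih]
    exact hasProjectiveDimensionLE_succ_iff (isShortExact_syzygy M)
      (coverMap_isProjectiveCover M).projective n

theorem extVanish_iff_iterate_syzygy {m n : ℕ} {M : FGModuleCat.{u} Λ} :
    ExtVanish (n + m) M ↔ ExtVanish m (syzygy^[n] M) := by
  induction n generalizing M with
  | zero => rw [zero_add, Function.iterate_zero_apply]
  | succ n ih =>
    have hP := ExtVanish.of_projective (coverMap_isProjectiveCover M).projective
    rw [Function.iterate_succ_apply, ← ih, add_right_comm]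
    exact ⟨.left (isShortExact_syzygy M) (hP.mono (Nat.zero_le _)),
      fun h => .right (isShortExact_syzygy M) h (hP.mono (Nat.zero_le _))⟩

end Classes

/-! ### Left approximations by projectives and the cosyzygy on classes. -/

section Cosyzygy

variable {Λ : Type u} [Ring Λ]

/-- `M → P → C → 0` is exact with `P` projective, and every map from `M` to a projective module
factors through `M → P`. -/
structure IsCopresentation {M P C : FGModuleCat.{u} Λ} (f : M →ₗ[Λ] P) (q : P →ₗ[Λ] C) :
    Prop where
  projective : Module.Projective Λ P
  exact : Function.Exact f q
  surjective : Function.Surjective q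
  exists_extension : ∀ Q : FGModuleCat.{u} Λ, Module.Projective Λ Q → ∀ φ : M →ₗ[Λ] Q,
    ∃ ψ : P →ₗ[Λ] Q, ψ ∘ₗ f = φ

theorem IsCopresentation.comp_equiv {M N P C : FGModuleCat.{u} Λ} {f : M →ₗ[Λ] P}
    {q : P →ₗ[Λ] C} (h : IsCopresentation f q) (e : N ≃ₗ[Λ] M) :
    IsCopresentation (f ∘ₗ e.toLinearMap) q := by
  refine ⟨h.projective, fun x => ?_, h.surjective, fun Q hQ φ => ?_⟩
  · rw [h.exact x, LinearMap.coe_comp, LinearEquiv.coe_coe, e.surjective.range_comp]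
  · obtain ⟨ψ, hψ⟩ := h.exists_extension Q hQ (φ ∘ₗ e.symm.toLinearMap)
    refine ⟨ψ, LinearMap.ext fun x => ?_⟩
    have : ψ (f (e x)) = φ (e.symm (e x)) := LinearMap.congr_fun hψ (e x)
    rwa [e.symm_apply_apply] at this

theorem IsCopresentation.prod {M P C N Q D : FGModuleCat.{u} Λ} {f : M →ₗ[Λ] P}
    {q : P →ₗ[Λ] C} {g : N →ₗ[Λ] Q} {r : Q →ₗ[Λ] D} (h : IsCopresentation f q)
    (h' : IsCopresentation g r) :
    IsCopresentation (M := FGModuleCat.of Λ (M × N)) (P := FGModuleCat.of Λ (P × Q))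
      (C := FGModuleCat.of Λ (C × D)) (f.prodMap g) (q.prodMap r) := by
  have := h.projective
  have := h'.projective
  refine ⟨inferInstanceAs (Module.Projective Λ (P × Q)), ?_,
    Function.Surjective.prodMap h.surjective h'.surjective, fun T hT φ => ?_⟩
  · rintro ⟨x, y⟩
    constructor
    · intro hxy
      obtain ⟨a, rfl⟩ := (h.exact x).1 (congrArg Prod.fst hxy)
      obtain ⟨b, rfl⟩ := (h'.exact y).1 (congrArg Prod.snd hxy)
      exact ⟨(a, b), rfl⟩
    · rintro ⟨⟨a, b⟩, hab⟩
      rw [← hab]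
      exact Prod.ext (h.exact.apply_apply_eq_zero a) (h'.exact.apply_apply_eq_zero b)
  · obtain ⟨ψ, hψ⟩ := h.exists_extension T hT (φ ∘ₗ LinearMap.inl Λ M N)
    obtain ⟨χ, hχ⟩ := h'.exists_extension T hT (φ ∘ₗ LinearMap.inr Λ M N)
    refine ⟨ψ.coprod χ, ?_⟩
    refine LinearMap.ext fun ⟨x, y⟩ => ?_
    have h1 : ψ (f x) = φ (x, 0) := LinearMap.congr_fun hψ x
    have h2 : χ (g y) = φ (0, y) := LinearMap.congr_fun hχ y
    change ψ (f x) + χ (g y) = φ (x, y)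
    rw [h1, h2, ← map_add, Prod.mk_add_mk, add_zero, zero_add]

/-- The dual of Schanuel's lemma. -/
theorem IsCopresentation.nonempty_equiv {M P C Q D : FGModuleCat.{u} Λ} {f : M →ₗ[Λ] P}
    {q : P →ₗ[Λ] C} {g : M →ₗ[Λ] Q} {r : Q →ₗ[Λ] D} (h : IsCopresentation f q)
    (h' : IsCopresentation g r) : Nonempty ((C × Q) ≃ₗ[Λ] (D × P)) := by
  obtain ⟨a, ha⟩ := h.exists_extension Q h'.projective g
  obtain ⟨b, hb⟩ := h'.exists_extension P h.projective f
  have ha : ∀ x, a (f x) = g x := fun x => LinearMap.congr_fun ha x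
  have hb : ∀ x, b (g x) = f x := fun x => LinearMap.congr_fun hb x
  let s : (P × Q) →ₗ[Λ] (C × Q) :=
    (q ∘ₗ LinearMap.fst Λ P Q).prod (a ∘ₗ LinearMap.fst Λ P Q - LinearMap.snd Λ P Q)
  let t : (P × Q) →ₗ[Λ] (D × P) :=
    (r ∘ₗ LinearMap.snd Λ P Q).prod (b ∘ₗ LinearMap.snd Λ P Q - LinearMap.fst Λ P Q)
  have hs : ∀ x y, s (x, y) = (q x, a x - y) := fun _ _ => rfl
  have ht : ∀ x y, t (x, y) = (r y, b y - x) := fun _ _ => rfl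
  have hs' : Function.Surjective s := by
    rintro ⟨c, y⟩
    obtain ⟨x, rfl⟩ := h.surjective c
    exact ⟨(x, a x - y), by rw [hs, sub_sub_cancel]⟩
  have ht' : Function.Surjective t := by
    rintro ⟨d, x⟩
    obtain ⟨y, rfl⟩ := h'.surjective d
    exact ⟨(b y - x, y), by rw [ht, sub_sub_cancel]⟩
  -- Both kernels consist of the pairs `(f m, g m)`, so the two targets are the same quotient of `P
  -- × Q`.
  have hker : LinearMap.ker s = LinearMap.ker t := by
    ext ⟨x, y⟩
    rw [LinearMap.mem_ker, LinearMap.mem_ker, hs, ht, Prod.mk_eq_zero, Prod.mk_eq_zero,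
      sub_eq_zero, sub_eq_zero]
    constructor
    · rintro ⟨hx, rfl⟩
      obtain ⟨m, rfl⟩ := (h.exact x).1 hx
      rw [ha]
      exact ⟨h'.exact.apply_apply_eq_zero m, hb m⟩
    · rintro ⟨hy, rfl⟩
      obtain ⟨m, rfl⟩ := (h'.exact y).1 hy
      rw [hb]
      exact ⟨h.exact.apply_apply_eq_zero m, ha m⟩
  exact ⟨(s.quotKerEquivOfSurjective hs').symm.trans
    ((Submodule.quotEquivOfEq _ _ hker).trans (t.quotKerEquivOfSurjective ht'))⟩

theorem IsShortExact.isCopresentation {A P C : FGModuleCat.{u} Λ} {i : A →ₗ[Λ] P}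
    {p : P →ₗ[Λ] C} (h : IsShortExact i p) (hP : Module.Projective Λ P) (hC : ExtVanish 0 C) :
    IsCopresentation i p :=
  ⟨hP, h.exact, h.surjective, fun _ hQ φ => hC.exists_extension h hQ φ⟩

theorem IsCopresentation.clsBar_eq [IsArtinianRing Λ] {M P C N Q D : FGModuleCat.{u} Λ}
    {f : M →ₗ[Λ] P} {q : P →ₗ[Λ] C} {g : N →ₗ[Λ] Q} {r : Q →ₗ[Λ] D} (h : IsCopresentation f q)
    (h' : IsCopresentation g r) (e : M ≃ₗ[Λ] N) : clsBar C = clsBar D := by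
  obtain ⟨e⟩ := h.nonempty_equiv (h'.comp_equiv e)
  have h1 := clsBar_eq_of_equiv (M := FGModuleCat.of Λ (C × Q)) (N := FGModuleCat.of Λ (D × P)) e
  rwa [clsBar_of_prod, clsBar_of_prod,
    clsBar_eq_zero_of_projective h.projective, clsBar_eq_zero_of_projective h'.projective,
    add_zero, add_zero] at h1

/-- A map to `Λ` is determined by its values on generators of `M`, so `Hom(M, Λ)` embeds in a finite
power of `Λ` and is finitely generated over the base ring. Its generators are the coordinates of
`f`, which need not be injective. Projectives other than `Λ` are handled as retracts of its powers.
-/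
theorem exists_isCopresentation [IsArtinAlgebra Λ] (M : FGModuleCat.{u} Λ) :
    ∃ (P C : FGModuleCat.{u} Λ) (f : M →ₗ[Λ] P) (q : P →ₗ[Λ] C), IsCopresentation f q := by
  obtain ⟨R, _, _, _, _⟩ := IsArtinAlgebra.exists_base (Λ := Λ)
  obtain ⟨n, π, hπ⟩ := Module.Finite.exists_fin' Λ M
  let F : (M →ₗ[Λ] Λ) →ₗ[R] (Fin n → Λ) :=
    { toFun := fun φ i => φ (π (Pi.single i 1))
      map_add' := fun _ _ => rfl
      map_smul' := fun _ _ => rfl }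
  have hF : Function.Injective F := by
    intro φ ψ h
    have : φ ∘ₗ π = ψ ∘ₗ π := by
      refine LinearMap.pi_ext' fun i => LinearMap.ext_ring ?_
      exact congrFun h i
    refine LinearMap.ext fun m => ?_
    obtain ⟨x, rfl⟩ := hπ m
    exact LinearMap.congr_fun this x
  have : Module.Finite R (M →ₗ[Λ] Λ) := Module.Finite.of_injective F hF
  obtain ⟨k, θ, hθ⟩ := Module.Finite.exists_fin' R (M →ₗ[Λ] Λ)
  let f : M →ₗ[Λ] FGModuleCat.of Λ (Fin k → Λ) :=
    LinearMap.pi fun i => θ (Pi.single i 1)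
  have hf : ∀ φ : M →ₗ[Λ] Λ, ∃ ψ : (Fin k → Λ) →ₗ[Λ] Λ, ψ ∘ₗ f = φ := by
    intro φ
    obtain ⟨c, rfl⟩ := hθ φ
    refine ⟨∑ i, c i • LinearMap.proj i, LinearMap.ext fun m => ?_⟩
    conv_rhs => rw [pi_eq_sum_univ' c, map_sum]
    simp [f, LinearMap.sum_apply]
  refine ⟨_, FGModuleCat.of Λ ((Fin k → Λ) ⧸ LinearMap.range f), f, (LinearMap.range f).mkQ,
    inferInstanceAs (Module.Projective Λ (Fin k → Λ)), LinearMap.exact_map_mkQ_range f,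
    Submodule.mkQ_surjective _, fun Q hQ φ => ?_⟩
  obtain ⟨m, a, b, -, -, hab⟩ := Module.Finite.exists_comp_eq_id_of_projective Λ Q
  choose ψ hψ using fun j => hf (LinearMap.proj j ∘ₗ b ∘ₗ φ)
  refine ⟨a ∘ₗ LinearMap.pi ψ, LinearMap.ext fun x => ?_⟩
  have h1 : LinearMap.pi ψ (f x) = b (φ x) := funext fun j => LinearMap.congr_fun (hψ j) x
  change a (LinearMap.pi ψ (f x)) = φ x
  rw [h1]
  exact LinearMap.congr_fun hab (φ x)

variable (Λ) in
/-- The syzygy has a left inverse on the classes of modules without extensions with projective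
modules. -/
theorem exists_cosyzygyHom [IsArtinAlgebra Λ] : ∃ F : KProj Λ →+ KProj Λ,
    ∀ M : FGModuleCat.{u} Λ, ExtVanish 0 M → F (syzygyHomBar Λ (clsBar M)) = clsBar M := by
  choose P C f q h using exists_isCopresentation (Λ := Λ)
  obtain ⟨F, hF⟩ := exists_hom_clsBar (fun M => clsBar (C M))
    (fun M X Y e => ((h M).clsBar_eq ((h X).prod (h Y)) e).trans
      (clsBar_of_prod (C X) (C Y)))
    (fun Q hQ => by
      have hid : IsCopresentation (C := FGModuleCat.of Λ PUnit.{u + 1})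
          (LinearMap.id : Q →ₗ[Λ] Q) 0 :=
        ⟨hQ, fun x => ⟨fun _ => ⟨x, rfl⟩, fun _ => rfl⟩, fun _ => ⟨0, rfl⟩,
          fun _ _ φ => ⟨φ, rfl⟩⟩
      rw [(h Q).clsBar_eq hid (LinearEquiv.refl Λ Q),
        clsBar_eq_zero_of_projective projective_punit])
  refine ⟨F, fun M hM => ?_⟩
  rw [syzygyHomBar_clsBar, hF]
  exact (h _).clsBar_eq ((isShortExact_syzygy M).isCopresentation
    (coverMap_isProjectiveCover M).projective hM) (LinearEquiv.refl Λ _)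

end Cosyzygy

/-! ### Stabilization index of an endomorphism. -/

section Eta

theorem bijOn_iterate_image_iff {A : Type*} (f : A → A) (X : Set A) (m : ℕ) :
    Set.BijOn f (f^[m] '' X) (f^[m + 1] '' X) ↔ Set.InjOn f (f^[m] '' X) := by
  have h : f^[m + 1] '' X = f '' (f^[m] '' X) := by
    rw [← Set.image_comp, ← Function.iterate_succ']
  rw [h]
  exact ⟨Set.BijOn.injOn, Set.InjOn.bijOn_image⟩

theorem eta_le {A : Type*} [AddCommGroup A] {f : A →+ A} {X : AddSubgroup A} {k : ℕ}
    (h : ∀ m ≥ k, Set.InjOn f (f^[m] '' X)) : eta f X ≤ k :=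
  Nat.sInf_le fun m hm => (bijOn_iterate_image_iff f X m).2 (h m hm)

/-- The hypothesis `h` ensures that the infimum defining `eta` is attained: over the empty set it
would be the default value `0`. -/
theorem injOn_of_eta_le {A : Type*} [AddCommGroup A] {f : A →+ A} {X : AddSubgroup A} {k : ℕ}
    (h : ∀ m ≥ k, Set.InjOn f (f^[m] '' X)) {m : ℕ} (hm : eta f X ≤ m) :
    Set.InjOn f (f^[m] '' X) := by
  have hne : {k : ℕ | ∀ m ≥ k, Set.BijOn f (f^[m] '' X) (f^[m + 1] '' X)}.Nonempty :=
    ⟨k, fun m hm => (bijOn_iterate_image_iff f X m).2 (h m hm)⟩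
  exact (Nat.sInf_mem hne m hm).injOn

end Eta

/-! ### The lower bound: finite projective dimension is at most `Phi`. -/

section IgusaTodorovFunctions

variable {Λ : Type u} [Ring Λ] [IsArtinianRing Λ]

theorem pd_le_Phi {M : FGModuleCat.{u} Λ} (hM : pd M < ⊤) : pd M ≤ Phi M := by
  obtain ⟨n, hn⟩ := ENat.ne_top_iff_exists.1 hM.ne
  have hMn := pd_le_iff.1 hn.ge
  have hzero : ∀ m ≥ n, Set.InjOn (syzygyHomBar Λ) ((syzygyHomBar Λ)^[m] '' genBar M) := by
    intro m hm
    have h0 : ∀ x ∈ (syzygyHomBar Λ)^[m] '' (genBar M : Set (KProj Λ)), x = 0 := by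
      intro x hx
      refine AddSubgroup.mem_bot.1 ((AddSubgroup.closure_le _).2 ?_
        (iterate_syzygyHomBar_image_genBar_subset m M hx))
      rintro _ ⟨X, hX, rfl⟩
      refine AddSubgroup.mem_bot.2 (clsBar_eq_zero_of_projective
        (hasProjectiveDimensionLE_iff_iterate_syzygy.1 ?_))
      obtain hX | hX := hX
      · exact hasProjectiveDimensionLE_mono hm (hasProjectiveDimensionLE_of_mem_addClosure hMn hX)
      · exact hasProjectiveDimensionLE_mono (Nat.zero_le m)
          (hasProjectiveDimensionLE_zero_iff.2 hX)
    intro x hx y hy _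
    rw [h0 x hx, h0 y hy]
  rw [← hn, Nat.cast_le]
  by_contra! hlt
  obtain ⟨k, rfl⟩ : ∃ k, n = k + 1 := ⟨n - 1, by omega⟩
  -- Here `k = pd M - 1`. Injectivity at this step would make the `k`-th syzygy projective, since
  -- its class and `0` have the same image, so `pd M ≤ k`.
  have hinj := injOn_of_eta_le hzero (m := k) (by exact Nat.le_of_lt_succ hlt)
  have hmem : clsBar (syzygy^[k] M) ∈ (syzygyHomBar Λ)^[k] '' (genBar M : Set (KProj Λ)) :=
    ⟨clsBar M, clsBar_mem_genBar M, iterate_syzygyHomBar_clsBar k M⟩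
  have hmem0 : (0 : KProj Λ) ∈ (syzygyHomBar Λ)^[k] '' (genBar M : Set (KProj Λ)) :=
    ⟨0, zero_mem _, iterate_map_zero _ _⟩
  have hproj := projective_of_clsBar_eq_zero (hinj hmem hmem0 (by
    rw [map_zero, syzygyHomBar_clsBar, ← Function.iterate_succ_apply' syzygy]
    exact clsBar_eq_zero_of_projective (hasProjectiveDimensionLE_iff_iterate_syzygy.1 hMn)))
  have := pd_le_iff.2 (hasProjectiveDimensionLE_iff_iterate_syzygy.2 hproj)
  rw [← hn, Nat.cast_le] at this
  omega

variable (Λ) in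
theorem finDim_le_PhiDim : finDim Λ ≤ PhiDim Λ :=
  iSup₂_le fun M _ => iSup_le fun hM => (pd_le_Phi hM).trans
    (le_iSup (fun M : FGModuleCat.{u} Λ => (Phi M : ℕ∞)) M)

variable (Λ) in
theorem PhiDim_le_PsiDim : PhiDim Λ ≤ PsiDim Λ :=
  iSup_mono fun _ => le_self_add

end IgusaTodorovFunctions

/-! ### The upper bound and the case of finite global dimension. -/

section UpperBound

variable {Λ : Type u} [Ring Λ] [IsArtinAlgebra Λ]

/-- For `m ≥ s` all `m`-th syzygies satisfy `ExtVanish 0`, so the cosyzygy map is a left inverse on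
their classes and, by additivity, on the subgroup they generate. -/
theorem Phi_le_of_extVanish {s : ℕ} (h : ∀ X : FGModuleCat.{u} Λ, ExtVanish s X)
    (M : FGModuleCat.{u} Λ) : Phi M ≤ s := by
  obtain ⟨F, hF⟩ := exists_cosyzygyHom Λ
  refine eta_le fun m hm => Set.LeftInvOn.injOn (f₁' := F) fun x hx => ?_
  replace hx := iterate_syzygyHomBar_image_genBar_subset m M hx
  induction hx using AddSubgroup.closure_induction with
  | mem x hx =>
    obtain ⟨X, -, rfl⟩ := hx
    exact hF _ (extVanish_iff_iterate_syzygy.1 ((h X).mono hm))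
  | zero => rw [map_zero, map_zero]
  | add x y _ _ hx hy => rw [map_add, map_add, hx, hy]
  | neg x _ hx => rw [map_neg, map_neg, hx]

theorem Psi_le_of_extVanish {s : ℕ} (h : ∀ X : FGModuleCat.{u} Λ, ExtVanish s X)
    (M : FGModuleCat.{u} Λ) : Psi M ≤ s := by
  have hle := Phi_le_of_extVanish h M
  have hE : ExtVanish (s - Phi M) (syzygy^[Phi M] M) :=
    extVanish_iff_iterate_syzygy.1 (by rw [Nat.add_sub_cancel' hle]; exact h M)
  have hfin : finDimClass {Z : FGModuleCat.{u} Λ | IsSummand Z (syzygy^[Phi M] M)} ≤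
      (s - Phi M : ℕ) := by
    refine iSup₂_le fun Z hZ => iSup_le fun hpd => ?_
    obtain ⟨k, hk⟩ := ENat.ne_top_iff_exists.1 hpd.ne
    exact pd_le_iff.2 (hasProjectiveDimensionLE_of_extVanish (pd_le_iff.1 hk.ge)
      (IsSummand.extVanish hZ hE))
  calc Psi M ≤ Phi M + (s - Phi M : ℕ) := add_le_add_right hfin _
    _ = s := by rw [← Nat.cast_add, Nat.add_sub_cancel' hle]

variable (Λ) in
theorem PsiDim_le (n : ℕ) : PsiDim Λ ≤ GpdClass (syzygyClass Λ n) + n := by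
  -- Only a finite supremum `m` gives a uniform vanishing bound `n + m`.
  by_cases htop : GpdClass (syzygyClass Λ n) = ⊤
  · rw [htop, top_add]
    exact le_top
  obtain ⟨m, hm⟩ := ENat.ne_top_iff_exists.1 htop
  rw [← hm, ← Nat.cast_add, add_comm]
  refine iSup_le (Psi_le_of_extVanish fun X => extVanish_iff_iterate_syzygy.2
    (extVanish_of_Gpd_le ?_))
  rw [hm]
  exact le_iSup₂_of_le (f := fun (M : FGModuleCat.{u} Λ) (_ : M ∈ syzygyClass Λ n) => Gpd M) _
    ⟨X, rfl⟩ le_rfl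

theorem PsiDim_le_glGpdim : PsiDim Λ ≤ glGpdim Λ := by
  have h := PsiDim_le Λ 0
  rwa [syzygyClass, Function.iterate_zero, Set.range_id, Nat.cast_zero, add_zero] at h

theorem glGpdim_eq_finDim (h : glGpdim Λ < ⊤) : glGpdim Λ = finDim Λ := by
  have hM : {M : FGModuleCat.{u} Λ | Gpd M < ⊤} = Set.univ := Set.eq_univ_of_forall fun M =>
    (le_iSup₂_of_le (f := fun (M : FGModuleCat.{u} Λ) (_ : M ∈ Set.univ) => Gpd M) M
      (Set.mem_univ M) le_rfl).trans_lt h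
  rw [← finGpdim_eq_finDim, finGpdim, hM, glGpdim]

end UpperBound

end IgusaTodorov

theorem theorem4 (Λ : Type u) [Ring Λ] [IsArtinAlgebra Λ] :
    (∀ n : ℕ,
      finGpdim Λ = finDim Λ ∧
      finDim Λ ≤ PhiDim Λ ∧
      PhiDim Λ ≤ PsiDim Λ ∧
      PsiDim Λ ≤ GpdClass (syzygyClass Λ n) + n) ∧
    (glGpdim Λ < ⊤ →
      finDim Λ = PhiDim Λ ∧
      PhiDim Λ = PsiDim Λ ∧
      PsiDim Λ = glGpdim Λ ∧
      glGpdim Λ ≤ injDim (FGModuleCat.of Λ Λ)) := by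
  refine ⟨fun n => ⟨finGpdim_eq_finDim Λ, finDim_le_PhiDim Λ, PhiDim_le_PsiDim Λ, PsiDim_le Λ n⟩,
    fun h => ?_⟩
  have h1 := finDim_le_PhiDim Λ
  have h2 := PhiDim_le_PsiDim Λ
  have h3 := PsiDim_le_glGpdim (Λ := Λ)
  have h4 := (glGpdim_eq_finDim h).le
  exact ⟨h1.antisymm (h2.trans (h3.trans h4)), h2.antisymm (h3.trans (h4.trans h1)),
    h3.antisymm (h4.trans (h1.trans h2)), glGpdim_le_injDim h⟩
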